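/- Let $\mathbb K$ be an algebraically closed field of characteristic zero, let $Y$ be an irreducible normal affine variety over $\mathbb K$ with coordinate ring $\mathbb K[Y]$, and let $f\in\mathbb K[Y]$ be nonzero and not invertible. Let $$X=\mathrm{Susp}(Y,f)=\{uv=f\}\subset \mathbb A^2_{u,v}\times Y$$ be the suspension, let $X_u\subseteq X$ be the open subset $\{u\neq 0\}$, and identify $\mathbb A^1_*\times Y$ with $X_u$ by $(t,y)\mapsto (u,v,y)=(t,f(y)/t,y)$, where $\mathbb A^1_*=\mathbb A^1\setminus\{0\}$. Let $E_1,\dots,E_s$ be the distinct prime divisors on $Y$ contained in $\{f=0\}$, and write $\mathrm{div}_Y(f)=a_1E_1+\dots+a_sE_s$. Put $D_i=\mathbb A^1\times E_i=\{u=0\}\cap(\mathbb A^2_{u,v}\times E_i)\subset X$; then $D_1,\dots,D_s$ are the prime divisors on $X$ contained in $\{u=0\}$. Then * the map $D\mapsto D\cap X_u$ on Weil divisors (a prime divisor contained in $X\setminus X_u$ goes to $0$) induces a homomorphism $\phi\colon \mathrm{Cl}(X)\to\mathrm{Cl}(X_u)$ of divisor class groups; * the map $D\mapsto \mathbb A^1_*\times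 D$ induces an isomorphism $\theta_Y\colon\mathrm{Cl}(Y)\to\mathrm{Cl}(\mathbb A^1_*\times Y)=\mathrm{Cl}(X_u)$; * the sequence $$0\longrightarrow\mathbb Z\stackrel{\xi}{\longrightarrow}\mathbb Z^s\stackrel{\psi}{\longrightarrow}\mathrm{Cl}(X)\stackrel{\phi'}{\longrightarrow}\mathrm{Cl}(Y)\longrightarrow 0$$ is exact, where $\xi(1)=(a_1,\dots,a_s)$, $\psi(b_1,\dots,b_s)=b_1[D_1]+\dots+b_s[D_s]$ and $\phi'=\theta_Y^{-1}\circ\phi$. -/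

import Mathlib

open scoped LaurentPolynomial

/-!
An irreducible affine variety over `K` is given by its coordinate ring, a domain of finite type
over `K`; its function field is the field of fractions of the coordinate ring, its irreducible
closed subvarieties are the prime ideals, and its principal open subset defined by `g ≠ 0` is
given by a localization of the coordinate ring away from `g`.
-/

/-- A prime divisor on the affine variety with coordinate ring `A`: an irreducible closed
subvariety of codimension one, given by its (prime) ideal, which has height one. -/
@[ext]
structure PrimeDivisor (A : Type*) [CommRing A] where
  /-- The ideal of the functions vanishing on the divisor. -/
  asIdeal : Ideal A
  isPrime : asIdeal.IsPrime
  height_eq_one : asIdeal.height = 1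

attribute [instance] PrimeDivisor.isPrime

namespace PrimeDivisor

variable {A : Type*} [CommRing A]

instance krullDimLE_localization (p : PrimeDivisor A) :
    Ring.KrullDimLE 1 (Localization.AtPrime p.asIdeal) := by
  rw [Ring.krullDimLE_iff,
    IsLocalization.AtPrime.ringKrullDim_eq_height p.asIdeal (Localization.AtPrime p.asIdeal),
    p.height_eq_one]
  rfl

variable [IsDomain A]

theorem asIdeal_ne_bot (p : PrimeDivisor A) : p.asIdeal ≠ ⊥ := by
  intro h
  have h1 := p.height_eq_one
  rw [h, Ideal.height_bot] at h1
  exact zero_ne_one h1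

/-- There is nothing strictly between `0` and a prime divisor. -/
theorem eq_of_le (p : PrimeDivisor A) {q : Ideal A} [q.IsPrime] (hq : q ≠ ⊥)
    (hqp : q ≤ p.asIdeal) : q = p.asIdeal := by
  by_contra hne
  have hlt : q < p.asIdeal := lt_of_le_of_ne hqp hne
  have : p.asIdeal.FiniteHeight := ⟨Or.inr (by rw [p.height_eq_one]; simp)⟩
  have h1 := Ideal.height_strict_mono_of_isPrime_of_isPrime hlt
  rw [p.height_eq_one, Order.lt_one_iff, Ideal.height_eq_zero_iff,
    IsDomain.minimalPrimes_eq_singleton_bot] at h1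
  exact hq h1

variable [IsNoetherianRing A]

/-- The order `ν_p(g)` of the zero or pole of the rational function `g ≠ 0` along the prime divisor
`p`: for a regular function `a` it is the length of `A_p / (a)`, and `ν_p(a / b) = ν_p(a) - ν_p(b)`.
If `A_p` is a discrete valuation ring, this is the normalized valuation. -/
noncomputable def ord (p : PrimeDivisor A) (g : FractionRing A) : ℤ :=
  WithZero.log (Ring.ordFrac (Localization.AtPrime p.asIdeal) g)

theorem ord_mul (p : PrimeDivisor A) {g h : FractionRing A} (hg : g ≠ 0) (hh : h ≠ 0) :
    p.ord (g * h) = p.ord g + p.ord h := by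
  unfold ord
  rw [map_mul, WithZero.log_mul ((map_ne_zero _).2 hg) ((map_ne_zero _).2 hh)]

theorem ord_algebraMap_eq_zero (p : PrimeDivisor A) {a : A} (ha : a ∉ p.asIdeal) :
    p.ord (algebraMap A (FractionRing A) a) = 0 := by
  unfold ord
  rw [IsScalarTower.algebraMap_apply A (Localization.AtPrime p.asIdeal) (FractionRing A),
    Ring.ordFrac_of_isUnit, WithZero.log_one]
  exact IsLocalization.map_units (Localization.AtPrime p.asIdeal)
    (⟨a, ha⟩ : p.asIdeal.primeCompl)

theorem finite_setOf_mem {a : A} (ha : a ≠ 0) : {p : PrimeDivisor A | a ∈ p.asIdeal}.Finite := by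
  refine Set.Finite.of_finite_image (f := asIdeal)
    ((Ideal.finite_minimalPrimes_of_isNoetherianRing A (Ideal.span {a})).subset ?_)
    (fun p _ q _ h ↦ PrimeDivisor.ext h)
  rintro _ ⟨p, hp, rfl⟩
  refine ⟨⟨p.isPrime, (Ideal.span_singleton_le_iff_mem _).2 hp⟩, ?_⟩
  rintro q ⟨hq, haq⟩ hqp
  refine (p.eq_of_le (q := q) ?_ hqp).ge
  rintro rfl
  exact ha (by simpa using haq)

theorem finite_setOf_ord_ne_zero {g : FractionRing A} (hg : g ≠ 0) :
    {p : PrimeDivisor A | p.ord g ≠ 0}.Finite := by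
  obtain ⟨a, b, hb, rfl⟩ := IsFractionRing.div_surjective (A := A) g
  have hb0 : b ≠ 0 := nonZeroDivisors.ne_zero hb
  have ha0 : a ≠ 0 := by
    rintro rfl
    simp at hg
  refine ((finite_setOf_mem ha0).union (finite_setOf_mem hb0)).subset fun p hp ↦ ?_
  by_contra hcon
  simp only [Set.mem_union, Set.mem_ofPred_eq, not_or] at hcon
  apply hp
  have hbK : algebraMap A (FractionRing A) b ≠ 0 := by simpa using hb0
  have h := p.ord_mul hg hbK
  rw [div_mul_cancel₀ _ hbK, p.ord_algebraMap_eq_zero hcon.1,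
    p.ord_algebraMap_eq_zero hcon.2] at h
  linarith

end PrimeDivisor

/-- The group `WDiv` of Weil divisors on the affine variety with coordinate ring `A`. -/
abbrev WDiv (A : Type*) [CommRing A] : Type _ := PrimeDivisor A →₀ ℤ

section DivisorClassGroup

variable {A : Type*} [CommRing A] [IsDomain A] [IsNoetherianRing A]

/-- The principal divisor `div(g) = ∑ ν_p(g) • p` of a rational function `g ≠ 0`. -/
noncomputable def principalDiv (g : (FractionRing A)ˣ) : WDiv A :=
  Finsupp.ofSupportFinite (fun p ↦ p.ord (g : FractionRing A))
    (PrimeDivisor.finite_setOf_ord_ne_zero g.ne_zero)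

@[simp]
theorem principalDiv_apply (g : (FractionRing A)ˣ) (p : PrimeDivisor A) :
    principalDiv g p = p.ord (g : FractionRing A) := rfl

theorem principalDiv_mul (g h : (FractionRing A)ˣ) :
    principalDiv (g * h) = principalDiv g + principalDiv h := by
  ext p
  simp [p.ord_mul g.ne_zero h.ne_zero]

/-- The homomorphism `g ↦ div(g)` from the multiplicative group of the function field. -/
noncomputable def principalDivHom (A : Type*) [CommRing A] [IsDomain A] [IsNoetherianRing A] :
    Additive (FractionRing A)ˣ →+ WDiv A :=
  AddMonoidHom.mk' (fun g ↦ principalDiv g.toMul) fun g h ↦ principalDiv_mul g.toMul h.toMul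

/-- A nonzero regular function, as an element of the multiplicative group of the function field. -/
noncomputable def regularUnit (a : A) [NeZero a] : (FractionRing A)ˣ :=
  Units.mk0 (algebraMap A (FractionRing A) a) (by simpa using NeZero.ne a)

/-- The divisor class group `Cl`: Weil divisors modulo principal divisors. -/
abbrev DivisorClassGroup (A : Type*) [CommRing A] [IsDomain A] [IsNoetherianRing A] : Type _ :=
  WDiv A ⧸ (principalDivHom A).range

/-- The class of a Weil divisor in the divisor class group. -/
noncomputable def divisorClass (Z : WDiv A) : DivisorClassGroup A :=
  QuotientAddGroup.mk Z

end DivisorClassGroup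

section OpenRestriction

variable {A : Type*} [CommRing A]

/-- The intersection `D ∩ U` of a prime divisor `D` with the principal open subset `U` given by
`g ≠ 0`, when `D` is not contained in the complement of `U`. Here `U` has coordinate ring `B`. -/
def PrimeDivisor.restrict (g : A) (B : Type*) [CommRing B] [Algebra A B]
    [IsLocalization.Away g B] (p : PrimeDivisor A) (hp : g ∉ p.asIdeal) : PrimeDivisor B where
  asIdeal := p.asIdeal.map (algebraMap A B)
  isPrime := IsLocalization.isPrime_of_isPrime_disjoint (Submonoid.powers g) B _ p.isPrime
    ((Ideal.disjoint_powers_iff_notMem g p.isPrime.isRadical).2 hp)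
  height_eq_one := by
    rw [IsLocalization.height_map_of_disjoint (Submonoid.powers g) p.asIdeal
      ((Ideal.disjoint_powers_iff_notMem g p.isPrime.isRadical).2 hp), p.height_eq_one]

open Classical in
/-- The homomorphism `WDiv(X) → WDiv(U)`, `D ↦ D ∩ U`, where `U` is the principal open subset
of `X` given by `g ≠ 0`, and a prime divisor contained in `X \ U` is mapped to `0`. Here `X` and `U`
have the coordinate rings `A` and `B`. -/
noncomputable def WDiv.restrict (g : A) (B : Type*) [CommRing B] [Algebra A B]
    [IsLocalization.Away g B] : WDiv A →+ WDiv B :=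
  Finsupp.liftAddHom fun p ↦
    if hp : g ∈ p.asIdeal then 0 else Finsupp.singleAddHom (p.restrict g B hp)

end OpenRestriction

section Cylinder

variable {R : Type*} [CommRing R]

theorem isNoetherianRing_laurentPolynomial [IsNoetherianRing R] : IsNoetherianRing R[T;T⁻¹] :=
  IsLocalization.isNoetherianRing (Submonoid.powers (Polynomial.X : Polynomial R)) _ inferInstance

attribute [instance] isNoetherianRing_laurentPolynomial

theorem map_algebraMap_laurentPolynomial (p : Ideal R) :
    p.map (algebraMap R R[T;T⁻¹]) =
      (p.map (Polynomial.C : R →+* Polynomial R)).map (algebraMap (Polynomial R) R[T;T⁻¹]) := by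
  rw [Ideal.map_map]
  congr 1
  ext r
  simp [LaurentPolynomial.algebraMap_eq_toLaurent]

theorem powers_X_disjoint_map_C (p : Ideal R) [p.IsPrime] :
    Disjoint (Submonoid.powers (Polynomial.X : Polynomial R) : Set (Polynomial R))
      (p.map (Polynomial.C : R →+* Polynomial R) : Set (Polynomial R)) := by
  rw [Ideal.disjoint_powers_iff_notMem _ Ideal.isPrime_map_C_of_isPrime.isRadical,
    Ideal.mem_map_C_iff]
  intro h
  have := h 1
  rw [Polynomial.coeff_X_one] at this
  exact ‹p.IsPrime›.ne_top ((Ideal.eq_top_iff_one p).2 this)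

theorem isPrime_map_laurentPolynomial (p : Ideal R) [p.IsPrime] :
    (p.map (algebraMap R R[T;T⁻¹])).IsPrime := by
  rw [map_algebraMap_laurentPolynomial]
  exact IsLocalization.isPrime_of_isPrime_disjoint
    (Submonoid.powers (Polynomial.X : Polynomial R)) _ _ Ideal.isPrime_map_C_of_isPrime
    (powers_X_disjoint_map_C p)

theorem comap_map_laurentPolynomial (p : Ideal R) [p.IsPrime] :
    (p.map (algebraMap R R[T;T⁻¹])).comap (algebraMap R R[T;T⁻¹]) = p := by
  refine le_antisymm (fun r hr ↦ ?_) Ideal.le_comap_map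
  have h1 : (Polynomial.C r : Polynomial R) ∈ p.map (Polynomial.C : R →+* Polynomial R) := by
    rw [← IsLocalization.under_map_of_isPrime_disjoint
      (Submonoid.powers (Polynomial.X : Polynomial R)) R[T;T⁻¹]
      (Ideal.isPrime_map_C_of_isPrime (P := p)) (powers_X_disjoint_map_C p)]
    rw [Ideal.mem_comap, map_algebraMap_laurentPolynomial] at hr
    rw [Ideal.under, Ideal.mem_comap]
    convert! hr
    simp [LaurentPolynomial.algebraMap_eq_toLaurent]
  simpa using Ideal.mem_map_C_iff.1 h1 0

variable [IsDomain R] [IsNoetherianRing R]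

/-- For a prime divisor `D` on `Y`, the prime divisor `𝔸¹_* × D` on `𝔸¹_* × Y`. Here `Y` has the
coordinate ring `R`, and `𝔸¹_* × Y` has the coordinate ring `R[T;T⁻¹]`. -/
noncomputable def PrimeDivisor.cylinder (p : PrimeDivisor R) : PrimeDivisor R[T;T⁻¹] where
  asIdeal := p.asIdeal.map (algebraMap R R[T;T⁻¹])
  isPrime := isPrime_map_laurentPolynomial p.asIdeal
  height_eq_one := by
    have := isPrime_map_laurentPolynomial p.asIdeal
    obtain ⟨a, hap, ha⟩ := Submodule.exists_mem_ne_zero_of_ne_bot p.asIdeal_ne_bot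
    have hinj : Function.Injective (algebraMap R R[T;T⁻¹]) := FaithfulSMul.algebraMap_injective _ _
    have hmem := Ideal.mem_map_of_mem (algebraMap R R[T;T⁻¹]) hap
    apply le_antisymm
    · apply Ideal.height_le_one_of_isPrincipal_of_mem_minimalPrimes
        (Ideal.span {algebraMap R R[T;T⁻¹] a})
      refine ⟨⟨inferInstance, (Ideal.span_singleton_le_iff_mem _).2 hmem⟩, ?_⟩
      rintro q ⟨hq, haq⟩ hqp
      rw [Ideal.span_singleton_le_iff_mem] at haq
      have h1 : q.comap (algebraMap R R[T;T⁻¹]) = p.asIdeal := by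
        refine p.eq_of_le (fun hbot ↦ ha ?_) ?_
        · have : a ∈ q.comap (algebraMap R R[T;T⁻¹]) := haq
          rwa [hbot, Ideal.mem_bot] at this
        · calc q.comap (algebraMap R R[T;T⁻¹])
              ≤ (p.asIdeal.map (algebraMap R R[T;T⁻¹])).comap (algebraMap R R[T;T⁻¹]) :=
                Ideal.comap_mono hqp
            _ = p.asIdeal := comap_map_laurentPolynomial p.asIdeal
      exact Ideal.map_le_iff_le_comap.2 h1.ge
    · rw [Order.one_le_iff_ne_zero, Ne, Ideal.height_eq_zero_iff,
        IsDomain.minimalPrimes_eq_singleton_bot, Set.mem_singleton_iff]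
      intro h
      rw [h, Ideal.mem_bot] at hmem
      exact ha (hinj (by simpa using hmem))

/-- The homomorphism `WDiv(Y) → WDiv(𝔸¹_* × Y)`, `D ↦ 𝔸¹_* × D`. -/
noncomputable def WDiv.cylinder : WDiv R →+ WDiv R[T;T⁻¹] :=
  Finsupp.mapDomain.addMonoidHom PrimeDivisor.cylinder

end Cylinder

/-- The coordinate ring `R[u, v] / (u v - f)` of the suspension `Susp(Y, f)`, the hypersurface
`u v = f` in `𝔸² × Y`, where `Y` has the coordinate ring `R`. -/
abbrev SuspRing (R : Type*) [CommRing R] (f : R) : Type _ :=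
  MvPolynomial (Fin 2) R ⧸
    Ideal.span {(MvPolynomial.X 0 * MvPolynomial.X 1 - MvPolynomial.C f : MvPolynomial (Fin 2) R)}

namespace SuspRing

variable {R : Type*} [CommRing R] (f : R)

/-- The coordinate function `u` on the suspension. -/
noncomputable def u : SuspRing R f := Ideal.Quotient.mk _ (MvPolynomial.X 0)

/-- The coordinate function `v` on the suspension. -/
noncomputable def v : SuspRing R f := Ideal.Quotient.mk _ (MvPolynomial.X 1)

theorem u_mul_v : u f * v f = algebraMap R (SuspRing R f) f := by
  unfold u v
  rw [← map_mul]
  exact (Ideal.Quotient.mk_eq_mk_iff_sub_mem _ _).2 (Ideal.subset_span rfl)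

/-- The comorphism of the open embedding `𝔸¹_* × Y → Susp(Y, f)`, `(t, y) ↦ (t, f(y) / t, y)`. It
identifies `𝔸¹_* × Y` with the principal open subset of the suspension given by `u ≠ 0`. -/
noncomputable def toLaurent : SuspRing R f →ₐ[R] R[T;T⁻¹] :=
  Ideal.Quotient.liftₐ _
    (MvPolynomial.aeval ![LaurentPolynomial.T 1, LaurentPolynomial.C f * LaurentPolynomial.T (-1)])
    (by
      intro a ha
      rw [← RingHom.mem_ker]
      refine (Ideal.span_singleton_le_iff_mem _).2 ?_ ha
      rw [RingHom.mem_ker]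
      simp only [map_sub, map_mul, MvPolynomial.aeval_X, MvPolynomial.aeval_C, Matrix.cons_val_zero,
        Matrix.cons_val_one, LaurentPolynomial.algebraMap_apply, Algebra.algebraMap_self,
        RingHom.id_apply]
      rw [mul_left_comm, ← LaurentPolynomial.T_add]
      simp)

@[simp]
theorem toLaurent_u : toLaurent f (u f) = LaurentPolynomial.T 1 := by
  refine (Ideal.Quotient.lift_mk _ _ _).trans ?_
  simp

@[simp]
theorem toLaurent_v :
    toLaurent f (v f) = LaurentPolynomial.C f * LaurentPolynomial.T (-1) := by
  refine (Ideal.Quotient.lift_mk _ _ _).trans ?_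
  simp

noncomputable instance algebraLaurent : Algebra (SuspRing R f) R[T;T⁻¹] :=
  (toLaurent f).toRingHom.toAlgebra

theorem algebraMap_laurent_apply (x : SuspRing R f) :
    algebraMap (SuspRing R f) R[T;T⁻¹] x = toLaurent f x := rfl

theorem toLaurent_aeval_u (P : Polynomial R) :
    toLaurent f (Polynomial.aeval (u f) P) = Polynomial.toLaurent P := by
  have h : (toLaurent f).comp (Polynomial.aeval (u f)) = Polynomial.toLaurentAlg := by
    ext
    simp
  exact DFunLike.congr_fun h P

theorem exists_u_pow_mul (x : SuspRing R f) :
    ∃ (n : ℕ) (P : Polynomial R), u f ^ n * x = Polynomial.aeval (u f) P := by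
  obtain ⟨F, rfl⟩ := Ideal.Quotient.mk_surjective x
  induction F using MvPolynomial.induction_on with
  | C a => exact ⟨0, Polynomial.C a, by
      rw [pow_zero, one_mul, Polynomial.aeval_C]; rfl⟩
  | add F G hF hG =>
    obtain ⟨m, P, hP⟩ := hF
    obtain ⟨n, Q, hQ⟩ := hG
    refine ⟨m + n, Polynomial.X ^ n * P + Polynomial.X ^ m * Q, ?_⟩
    simp only [map_add, map_mul, map_pow, Polynomial.aeval_X, ← hP, ← hQ]
    ring
  | mul_X F i hF =>
    obtain ⟨m, P, hP⟩ := hF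
    fin_cases i
    · refine ⟨m, P * Polynomial.X, ?_⟩
      simp only [map_mul, Polynomial.aeval_X, ← hP]
      rw [mul_assoc]
      rfl
    · refine ⟨m + 1, P * Polynomial.C f, ?_⟩
      simp only [map_mul, Polynomial.aeval_C, ← hP, ← u_mul_v]
      change _ * (_ * v f) = _
      ring

instance isLocalization_laurent : IsLocalization.Away (u f) R[T;T⁻¹] := by
  refine IsLocalization.Away.mk (u f) ?_ ?_ ?_
  · rw [algebraMap_laurent_apply, toLaurent_u]
    exact LaurentPolynomial.isUnit_T 1
  · intro s
    obtain ⟨n, P, hP⟩ := s.exists_T_pow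
    refine ⟨n, Polynomial.aeval (u f) P, ?_⟩
    rw [algebraMap_laurent_apply, algebraMap_laurent_apply, toLaurent_aeval_u, hP, toLaurent_u,
      LaurentPolynomial.T_pow]
    simp
  · intro a b hab
    rw [algebraMap_laurent_apply, algebraMap_laurent_apply] at hab
    obtain ⟨n, P, hP⟩ := exists_u_pow_mul f (a - b)
    refine ⟨n, ?_⟩
    have h : Polynomial.toLaurent P = 0 := by
      rw [← toLaurent_aeval_u f, ← hP, map_mul, map_sub, hab, sub_self, mul_zero]
    have hP0 : P = 0 := Polynomial.toLaurent_injective (by rw [h, map_zero])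
    rw [hP0, map_zero, mul_sub, sub_eq_zero] at hP
    exact hP

theorem u_mem_nonZeroDivisors [IsDomain R] [NeZero f] : u f ∈ nonZeroDivisors (SuspRing R f) := by
  rw [mem_nonZeroDivisors_iff_right]
  intro x hx
  obtain ⟨F, rfl⟩ := Ideal.Quotient.mk_surjective x
  unfold u at hx
  rw [← map_mul, Ideal.Quotient.eq_zero_iff_mem, Ideal.mem_span_singleton] at hx
  obtain ⟨G, hG⟩ := hx
  rw [Ideal.Quotient.eq_zero_iff_mem, Ideal.mem_span_singleton]
  have hdvd : (MvPolynomial.X 0 : MvPolynomial (Fin 2) R) ∣ MvPolynomial.C f * G :=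
    ⟨MvPolynomial.X 1 * G - F, by linear_combination hG⟩
  have hX : Prime (MvPolynomial.X 0 : MvPolynomial (Fin 2) R) := MvPolynomial.X_prime
  rcases hX.dvd_or_dvd hdvd with h | h
  · exfalso
    obtain ⟨H, hH⟩ := h
    have := congrArg (MvPolynomial.constantCoeff) hH
    simp only [map_mul, MvPolynomial.constantCoeff_C, MvPolynomial.constantCoeff_X,
      zero_mul] at this
    exact NeZero.ne f this
  · obtain ⟨H, rfl⟩ := h
    exact ⟨H, mul_right_cancel₀ hX.ne_zero (by linear_combination hG)⟩

theorem toLaurent_injective [IsDomain R] [NeZero f] : Function.Injective (toLaurent f) :=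
  IsLocalization.injective (M := Submonoid.powers (u f)) R[T;T⁻¹]
    (Submonoid.powers_le.2 (u_mem_nonZeroDivisors f))

instance isDomain [IsDomain R] [NeZero f] : IsDomain (SuspRing R f) :=
  (toLaurent_injective f).isDomain (toLaurent f).toRingHom

end SuspRing

/-! Removing the principal divisor `{u = 0}` from `X` yields an excision sequence. Restriction
`Cl(X) → Cl(X_u)` is onto, since every prime divisor of `X_u` has a closure in `X`; its kernel is
generated by the classes `[D i]`, since `X` and `X_u` have the same function field and the `D i` are
all the prime divisors in `{u = 0}`.

On `X_u = 𝔸¹_* × Y` one works over the generic point of `Y`, where the ring becomes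
`Frac(R)[T;T⁻¹]`, a principal ideal domain with units `c T ^ n`. A prime divisor that is not a
cylinder meets this generic fibre and is principal there, so every divisor is equivalent to a
cylinder (`WDiv.exists_cylinder_add_principalDiv`). A function whose divisor is a cylinder is a unit
there, hence equals `c T ^ n` (`exists_eq_fractionMap_mul_zpow`), and the cylinder is that of `div
c`. So `Cl(Y) ≅ Cl(X_u)`.

The same normal form computes the kernel of `ψ`: if `∑ b i • D i = div g`, then `g` has no zeros or
poles on `X_u`, so `g = c u ^ n` with `div c = 0` on `Y`, and `b = n • a`. Here `u` has order `a i`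
along `D i`, because `u v = f` and `v` does not vanish identically on `D i` (`ord_divisorOver_u`).

Orders on `Y` are compared with those on `𝔸¹_* × Y` and `X` by `ord_algebraMap_of_unramified`; this
is where normality of `Y` enters. Orders on `X` are lengths, so normality of `X` is not needed. -/

theorem Ring.ord_ringEquiv {S S' : Type*} [CommRing S] [CommRing S'] (e : S ≃+* S') (x : S) :
    Ring.ord S' (e x) = Ring.ord S x := by
  algebraize [e.toRingHom]
  have hI : Ideal.span {e x} = (Ideal.span {x}).map (algebraMap S S') := by
    rw [Ideal.map_span, Set.image_singleton]
    rfl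
  let E : (S ⧸ Ideal.span {x}) ≃ₐ[S] (S' ⧸ Ideal.span {e x}) :=
    Ideal.quotientEquivAlg _ _ (AlgEquiv.ofRingEquiv (f := e) fun _ ↦ rfl) hI
  rw [Ring.ord, Ring.ord, E.toLinearEquiv.length_eq]
  exact (Module.length_eq_of_surjective (S := S) (R := S') e.surjective).symm

/-! ### Orders of functions along prime divisors. -/

namespace PrimeDivisor

section Order

variable {A : Type*} [CommRing A] [IsDomain A]

theorem exists_mem_asIdeal (p : PrimeDivisor A) : ∃ a ∈ p.asIdeal, a ≠ 0 :=
  Submodule.exists_mem_ne_zero_of_ne_bot p.asIdeal_ne_bot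

theorem algebraMap_localization_ne_zero (p : PrimeDivisor A) {a : A} (ha : a ≠ 0) :
    algebraMap A (Localization.AtPrime p.asIdeal) a ≠ 0 := by
  simpa using ha

variable [IsNoetherianRing A]

/-- Krull's principal ideal theorem: a prime minimal over `(a)` inside `q` has height at most one,
and it is nonzero. -/
theorem exists_le_of_mem {q : Ideal A} [q.IsPrime] {a : A} (ha : a ≠ 0) (haq : a ∈ q) :
    ∃ p : PrimeDivisor A, a ∈ p.asIdeal ∧ p.asIdeal ≤ q := by
  obtain ⟨p, hp, hpq⟩ := Ideal.exists_minimalPrimes_le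
    ((Ideal.span_singleton_le_iff_mem q).2 haq)
  have hpp : p.IsPrime := hp.1.1
  have hap : a ∈ p := (Ideal.span_singleton_le_iff_mem _).1 hp.1.2
  refine ⟨⟨p, hpp, le_antisymm
    (Ideal.height_le_one_of_isPrincipal_of_mem_minimalPrimes (Ideal.span {a}) p hp) ?_⟩, hap, hpq⟩
  rw [Order.one_le_iff_ne_zero, Ne, Ideal.height_eq_zero_iff,
    IsDomain.minimalPrimes_eq_singleton_bot, Set.mem_singleton_iff]
  rintro rfl
  exact ha (by simpa using hap)

theorem ord_algebraMap (p : PrimeDivisor A) {a : A} (ha : a ≠ 0) :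
    p.ord (algebraMap A (FractionRing A) a) =
      (Ring.ord (Localization.AtPrime p.asIdeal)
        (algebraMap A (Localization.AtPrime p.asIdeal) a)).toNat := by
  have h0 := p.algebraMap_localization_ne_zero ha
  have h1 := mem_nonZeroDivisors_of_ne_zero h0
  unfold ord
  rw [IsScalarTower.algebraMap_apply A (Localization.AtPrime p.asIdeal) (FractionRing A),
    Ring.ordFrac_eq_ord _ h0, Ring.ordMonoidWithZeroHom_eq_coe _ h1
      (n := (Ring.ord (Localization.AtPrime p.asIdeal)
        (algebraMap A (Localization.AtPrime p.asIdeal) a)).toNat)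
      (ENat.natCast_toNat (Ring.ord_ne_top h1)).symm]
  rfl

theorem ord_algebraMap_pos (p : PrimeDivisor A) {a : A} (ha : a ≠ 0) (hap : a ∈ p.asIdeal) :
    0 < p.ord (algebraMap A (FractionRing A) a) := by
  have h1 := mem_nonZeroDivisors_of_ne_zero (p.algebraMap_localization_ne_zero ha)
  rw [ord_algebraMap p ha, Nat.cast_pos, pos_iff_ne_zero, Ne, ENat.toNat_eq_zero, not_or]
  refine ⟨?_, Ring.ord_ne_top h1⟩
  rw [Ring.ord, Module.length_eq_zero_iff, Ideal.Quotient.subsingleton_iff,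
    Ideal.span_singleton_eq_top]
  exact fun h ↦ (IsLocalization.AtPrime.isUnit_to_map_iff _ p.asIdeal a).1 h hap

theorem ord_one (p : PrimeDivisor A) : p.ord 1 = 0 := by
  have := p.ord_mul (one_ne_zero (α := FractionRing A)) one_ne_zero
  rw [mul_one] at this
  linarith

theorem ord_pow (p : PrimeDivisor A) {g : FractionRing A} (hg : g ≠ 0) (n : ℕ) :
    p.ord (g ^ n) = n * p.ord g := by
  induction n with
  | zero => simp [ord_one]
  | succ n ih =>
    rw [pow_succ, p.ord_mul (pow_ne_zero _ hg) hg, ih]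
    push_cast
    ring

theorem ord_inv (p : PrimeDivisor A) {g : FractionRing A} (hg : g ≠ 0) :
    p.ord g⁻¹ = - p.ord g := by
  have := p.ord_mul hg (inv_ne_zero hg)
  rw [mul_inv_cancel₀ hg, ord_one] at this
  linarith

theorem ord_div (p : PrimeDivisor A) {g h : FractionRing A} (hg : g ≠ 0) (hh : h ≠ 0) :
    p.ord (g / h) = p.ord g - p.ord h := by
  rw [div_eq_mul_inv, p.ord_mul hg (inv_ne_zero hh), p.ord_inv hh, sub_eq_add_neg]

theorem ord_zpow (p : PrimeDivisor A) {g : FractionRing A} (hg : g ≠ 0) (n : ℤ) :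
    p.ord (g ^ n) = n * p.ord g := by
  cases n with
  | ofNat n => simpa using p.ord_pow hg n
  | negSucc n =>
    rw [zpow_negSucc, p.ord_inv (pow_ne_zero _ hg), p.ord_pow hg, Int.negSucc_eq]
    push_cast
    ring

theorem ord_algebraMap_mul (p : PrimeDivisor A) {a b : A} (ha : a ≠ 0) (hb : b ≠ 0) :
    p.ord (algebraMap A (FractionRing A) (a * b)) =
      p.ord (algebraMap A (FractionRing A) a) + p.ord (algebraMap A (FractionRing A) b) := by
  rw [map_mul, p.ord_mul (by simpa using ha) (by simpa using hb)]

/-- A function generating the ideal of `p` locally at `p` vanishes there to order one. -/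
theorem ord_eq_one (p : PrimeDivisor A) {π : A} (hπ : π ∈ p.asIdeal)
    (h : ∀ x ∈ p.asIdeal, ∃ s ∉ p.asIdeal, π ∣ s * x) :
    p.ord (algebraMap A (FractionRing A) π) = 1 := by
  have hπ0 : π ≠ 0 := by
    rintro rfl
    obtain ⟨x, hx, hx0⟩ := p.exists_mem_asIdeal
    obtain ⟨s, hs, hsx⟩ := h x hx
    rw [zero_dvd_iff, mul_eq_zero] at hsx
    rcases hsx with rfl | hsx
    · exact hs (zero_mem _)
    · exact hx0 hsx
  -- The element `π` generates the maximal ideal of the local ring, so the quotient is the residue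
  -- field, of length one.
  have hmax : Ideal.span {algebraMap A (Localization.AtPrime p.asIdeal) π} =
      IsLocalRing.maximalIdeal (Localization.AtPrime p.asIdeal) := by
    rw [← Localization.AtPrime.map_eq_maximalIdeal]
    apply le_antisymm
    · rw [Ideal.span_singleton_le_iff_mem]
      exact Ideal.mem_map_of_mem _ hπ
    · rw [Ideal.map_le_iff_le_comap]
      intro x hx
      obtain ⟨s, hs, hsx⟩ := h x hx
      rw [Ideal.mem_comap, Ideal.mem_span_singleton]
      have hu : IsUnit (algebraMap A (Localization.AtPrime p.asIdeal) s) :=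
        IsLocalization.map_units (Localization.AtPrime p.asIdeal) (⟨s, hs⟩ : p.asIdeal.primeCompl)
      rw [← hu.dvd_mul_left, ← map_mul]
      exact map_dvd _ hsx
  rw [ord_algebraMap p hπ0, Ring.ord, hmax]
  have : IsSimpleModule (Localization.AtPrime p.asIdeal)
      (Localization.AtPrime p.asIdeal ⧸
        IsLocalRing.maximalIdeal (Localization.AtPrime p.asIdeal)) := by
    exact isSimpleModule_iff_quot_maximal.2 ⟨_, inferInstance, ⟨LinearEquiv.refl _ _⟩⟩
  rw [Module.length_eq_one]
  rfl

/-- The local ring at `p` is Noetherian, normal and one-dimensional, hence a discrete valuation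
ring. The facts about its uniformizer are stated in `A` itself, with denominators cleared by
elements outside `p`. -/
theorem exists_uniformizer [IsIntegrallyClosed A] (p : PrimeDivisor A) :
    ∃ π ∈ p.asIdeal, (∀ x ∈ p.asIdeal, ∃ s ∉ p.asIdeal, π ∣ s * x) ∧
      ∀ a ≠ 0, ∃ (n : ℕ), ∃ s ∉ p.asIdeal, ∃ t ∉ p.asIdeal, t * a = s * π ^ n := by
  let S := Localization.AtPrime p.asIdeal
  have hle := p.asIdeal.primeCompl_le_nonZeroDivisors
  have hinj : Function.Injective (algebraMap A S) := IsLocalization.injective S hle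
  have hic : IsIntegrallyClosed S := isIntegrallyClosed_of_isLocalization S p.asIdeal.primeCompl hle
  have hdim (P : Ideal S) (hP : P ≠ ⊥) (hP' : P.IsPrime) : P = IsLocalRing.maximalIdeal S :=
    IsLocalRing.eq_maximalIdeal (Ring.krullDimLE_one_iff_of_isPrime_bot.1 inferInstance P hP hP')
  have hpid : IsPrincipalIdealRing S :=
    ((tfae_of_isNoetherianRing_of_isLocalRing_of_isDomain S).out 3 0 :).1 (And.intro hic hdim)
  have hdvr : IsDiscreteValuationRing S := { hpid with
    not_a_field' := by
      rw [← Localization.AtPrime.map_eq_maximalIdeal, Ne, Ideal.map_eq_bot_iff_of_injective hinj]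
      exact p.asIdeal_ne_bot }
  have isUnit_iff (a : A) : IsUnit (algebraMap A S a) ↔ a ∉ p.asIdeal :=
    IsLocalization.AtPrime.isUnit_to_map_iff _ p.asIdeal a
  obtain ⟨ϖ, hϖ⟩ := IsDiscreteValuationRing.exists_irreducible S
  -- The denominator `d` is a unit of `S`, so the numerator is a uniformizer as well.
  obtain ⟨π, d, rfl⟩ := IsLocalization.exists_mk'_eq p.asIdeal.primeCompl ϖ
  have hd : IsUnit (algebraMap A S d) := (isUnit_iff _).2 d.2
  have hπ : Irreducible (algebraMap A S π) := by
    rw [← IsLocalization.mk'_spec S π d, irreducible_mul_isUnit hd]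
    exact hϖ
  have hπp : π ∈ p.asIdeal := by
    by_contra h
    exact hπ.not_isUnit ((isUnit_iff π).2 h)
  refine ⟨π, hπp, fun x hx ↦ ?_, fun a ha ↦ ?_⟩
  · have hxm : algebraMap A S x ∈ IsLocalRing.maximalIdeal S := by
      rw [IsLocalRing.mem_maximalIdeal, mem_nonunits_iff, isUnit_iff, not_not]
      exact hx
    rw [hπ.maximalIdeal_eq, Ideal.mem_span_singleton] at hxm
    obtain ⟨y, hy⟩ := hxm
    obtain ⟨c, s, rfl⟩ := IsLocalization.exists_mk'_eq p.asIdeal.primeCompl y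
    refine ⟨s, s.2, c, hinj ?_⟩
    rw [map_mul, map_mul, hy, mul_left_comm, mul_comm (algebraMap A S s),
      IsLocalization.mk'_spec]
  · obtain ⟨n, u, hu⟩ := IsDiscreteValuationRing.eq_unit_mul_pow_irreducible
      (p.algebraMap_localization_ne_zero ha) hπ
    obtain ⟨s, t, hst⟩ := IsLocalization.exists_mk'_eq p.asIdeal.primeCompl (u : S)
    have hs : algebraMap A S s = u * algebraMap A S t := by
      rw [← hst, IsLocalization.mk'_spec]
    refine ⟨n, s, (isUnit_iff s).1 ?_, (t : A), t.2, hinj ?_⟩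
    · rw [hs]
      exact u.isUnit.mul ((isUnit_iff _).2 t.2)
    · rw [map_mul, hu, map_mul, map_pow, hs]
      ring

/-- If a prime divisor `q` of `B` is, locally at `q`, the scheme-theoretic preimage of the
prime divisor `p` of the normal ring `A`, then orders along `p` and `q` agree. -/
theorem ord_algebraMap_of_unramified [IsIntegrallyClosed A] {B : Type*} [CommRing B] [IsDomain B]
    [IsNoetherianRing B] [Algebra A B] [FaithfulSMul A B] (p : PrimeDivisor A) (q : PrimeDivisor B)
    (hpq : q.asIdeal.comap (algebraMap A B) = p.asIdeal)
    (h : ∀ x ∈ q.asIdeal, ∃ s ∉ q.asIdeal, s * x ∈ p.asIdeal.map (algebraMap A B))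
    {a : A} (ha : a ≠ 0) :
    q.ord (algebraMap B (FractionRing B) (algebraMap A B a)) =
      p.ord (algebraMap A (FractionRing A) a) := by
  have hinj := FaithfulSMul.algebraMap_injective A B
  have hmem (x : A) : algebraMap A B x ∈ q.asIdeal ↔ x ∈ p.asIdeal := by
    rw [← hpq, Ideal.mem_comap]
  obtain ⟨π, hπp, hπ, hfac⟩ := p.exists_uniformizer
  -- The uniformizer of `p` also generates `q` locally, because it generates the extension of `p`
  -- locally and that extension is `q` near `q`.
  have hq : q.ord (algebraMap B (FractionRing B) (algebraMap A B π)) = 1 := by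
    refine q.ord_eq_one ((hmem π).2 hπp) fun x hx ↦ ?_
    obtain ⟨s, hs, hsx⟩ := h x hx
    have key : ∀ y ∈ p.asIdeal.map (algebraMap A B), ∃ t ∉ q.asIdeal, algebraMap A B π ∣ t * y := by
      intro y hy
      refine Submodule.span_induction ?_ ?_ ?_ ?_ hy
      · rintro _ ⟨z, hz, rfl⟩
        obtain ⟨t, ht, htz⟩ := hπ z hz
        refine ⟨algebraMap A B t, fun h ↦ ht ((hmem t).1 h), ?_⟩
        rw [← map_mul]
        exact map_dvd _ htz
      · exact ⟨1, q.asIdeal.one_notMem, by simp⟩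
      · rintro y z - - ⟨t, ht, hty⟩ ⟨t', ht', htz⟩
        refine ⟨t * t', q.asIdeal.primeCompl.mul_mem ht ht', ?_⟩
        rw [mul_add, mul_right_comm, mul_assoc t t']
        exact dvd_add (hty.mul_right _) (htz.mul_left _)
      · rintro r y - ⟨t, ht, hty⟩
        refine ⟨t, ht, ?_⟩
        rw [smul_eq_mul, mul_left_comm]
        exact hty.mul_left _
    obtain ⟨t, ht, htx⟩ := key _ hsx
    exact ⟨t * s, q.asIdeal.primeCompl.mul_mem ht hs, by rwa [mul_assoc]⟩
  have hp := p.ord_eq_one hπp hπ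
  have hπ0 : π ≠ 0 := by
    rintro rfl
    -- The order of `0` is by convention `0`, not `1`.
    simp [ord] at hp
  -- Up to factors outside `p`, which stay outside `q`, the element `a` is `π ^ n`; both orders are
  -- therefore `n`.
  obtain ⟨n, s, hs, t, ht, hst⟩ := hfac a ha
  have hs0 : s ≠ 0 := fun h ↦ hs (h ▸ zero_mem _)
  have ht0 : t ≠ 0 := fun h ↦ ht (h ▸ zero_mem _)
  have inj0 {x : A} (hx : x ≠ 0) : algebraMap A B x ≠ 0 := by simpa using hx
  have e1 := p.ord_algebraMap_mul ht0 ha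
  have e2 := q.ord_algebraMap_mul (inj0 ht0) (inj0 ha)
  rw [p.ord_algebraMap_eq_zero ht, zero_add, hst,
    p.ord_algebraMap_mul hs0 (pow_ne_zero n hπ0), p.ord_algebraMap_eq_zero hs, zero_add,
    map_pow, p.ord_pow (by simpa using hπ0), hp] at e1
  rw [q.ord_algebraMap_eq_zero (fun h ↦ ht ((hmem t).1 h)), zero_add, ← map_mul, hst, map_mul,
    q.ord_algebraMap_mul (inj0 hs0) (inj0 (pow_ne_zero n hπ0)),
    q.ord_algebraMap_eq_zero (fun h ↦ hs ((hmem s).1 h)), zero_add,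
    map_pow, map_pow, q.ord_pow (by simpa using hπ0), hq] at e2
  rw [← e1, ← e2]

end Order

/-! ### Restriction of divisors to a principal open subset. -/

section Localization

variable {A : Type*} [CommRing A]

/-- The closure in `X` of a prime divisor on the principal open subset `U` given by `g ≠ 0`,
where `X` and `U` have the coordinate rings `A` and `B`. -/
def contract (g : A) {B : Type*} [CommRing B] [Algebra A B] [IsLocalization.Away g B]
    (q : PrimeDivisor B) : PrimeDivisor A where
  asIdeal := q.asIdeal.comap (algebraMap A B)
  isPrime := inferInstance
  height_eq_one := by
    rw [← q.height_eq_one]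
    exact (IsLocalization.height_under (Submonoid.powers g) q.asIdeal)

variable (g : A) {B : Type*} [CommRing B] [Algebra A B] [IsLocalization.Away g B]

theorem notMem_contract (q : PrimeDivisor B) : g ∉ (q.contract g).asIdeal := fun h ↦
  q.isPrime.ne_top (Ideal.eq_top_of_isUnit_mem _ h (IsLocalization.Away.algebraMap_isUnit g))

theorem restrict_contract (q : PrimeDivisor B) :
    (q.contract g).restrict g B (q.notMem_contract g) = q :=
  PrimeDivisor.ext (IsLocalization.map_under (Submonoid.powers g) B q.asIdeal)

theorem contract_injective :
    Function.Injective (contract g : PrimeDivisor B → PrimeDivisor A) := by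
  intro q q' h
  rw [← restrict_contract g q, ← restrict_contract g q']
  congr

theorem contract_restrict (p : PrimeDivisor A) (hp : g ∉ p.asIdeal) :
    (p.restrict g B hp).contract g = p :=
  PrimeDivisor.ext (IsLocalization.under_map_of_isPrime_disjoint (Submonoid.powers g) B p.isPrime
    ((Ideal.disjoint_powers_iff_notMem g p.isPrime.isRadical).2 hp))

/-- Closure and intersection with `U` are inverse bijections between prime divisors of `U` and those
of `X` not inside `{g = 0}`. This turns restriction into reading off coefficients at closures. -/
theorem _root_.WDiv.restrict_apply (Z : WDiv A) (q : PrimeDivisor B) :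
    Z.restrict g B q = Z (q.contract g) := by
  induction Z using Finsupp.induction_linear with
  | zero => simp
  | add Z W hZ hW => simp [hZ, hW]
  | single p n =>
    classical
    simp only [WDiv.restrict, Finsupp.liftAddHom_apply_single]
    split_ifs with hp
    · rw [Finsupp.single_apply, if_neg]
      · rfl
      · rintro rfl
        exact q.notMem_contract g hp
    · simp only [Finsupp.singleAddHom_apply, Finsupp.single_apply]
      congr 1
      apply propext
      constructor
      · rintro rfl
        exact (p.contract_restrict g hp).symm
      · rintro rfl
        exact q.restrict_contract g

theorem _root_.WDiv.restrict_surjective : Function.Surjective (WDiv.restrict g B) := by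
  intro W
  refine ⟨Finsupp.mapDomain (contract g) W, ?_⟩
  ext q
  rw [WDiv.restrict_apply, Finsupp.mapDomain_apply]
  exact contract_injective g

variable [IsDomain A] [IsNoetherianRing A] [IsDomain B] [IsNoetherianRing B] [FaithfulSMul A B]

/-- A localization of a localization: `U` and `X` have the same local ring at `q` and at its
closure. -/
theorem ord_algebraMap_contract (q : PrimeDivisor B) {a : A} (ha : a ≠ 0) :
    q.ord (algebraMap B (FractionRing B) (algebraMap A B a)) =
      (q.contract g).ord (algebraMap A (FractionRing A) a) := by
  have hB : algebraMap A B a ≠ 0 := by simpa using ha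
  rw [ord_algebraMap _ ha, ord_algebraMap _ hB]
  congr 1
  have : IsLocalization.AtPrime (Localization.AtPrime q.asIdeal) (q.contract g).asIdeal :=
    IsLocalization.isLocalization_isLocalization_atPrime_isLocalization (Submonoid.powers g)
      (Localization.AtPrime q.asIdeal) q.asIdeal
  let e : Localization.AtPrime (q.contract g).asIdeal ≃ₐ[A] Localization.AtPrime q.asIdeal :=
    IsLocalization.algEquiv (q.contract g).asIdeal.primeCompl _ _
  have he : e.toRingEquiv (algebraMap A _ a) = algebraMap B _ (algebraMap A B a) := by
    rw [← IsScalarTower.algebraMap_apply]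
    exact e.commutes a
  rw [← he, Ring.ord_ringEquiv]

end Localization

/-! ### Maps of function fields and principal divisors. -/

section FractionMap

variable {A B : Type*} [CommRing A] [IsDomain A] [CommRing B] [IsDomain B] [Algebra A B]
  [FaithfulSMul A B]

/-- The inclusion of function fields given by an injective homomorphism of coordinate rings. -/
noncomputable def _root_.fractionMap (A B : Type*) [CommRing A] [IsDomain A] [CommRing B]
    [IsDomain B] [Algebra A B] [FaithfulSMul A B] : FractionRing A →+* FractionRing B :=
  IsFractionRing.map (FaithfulSMul.algebraMap_injective A B)

theorem _root_.fractionMap_algebraMap (a : A) :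
    fractionMap A B (algebraMap A (FractionRing A) a) =
      algebraMap B (FractionRing B) (algebraMap A B a) :=
  by rw [fractionMap, IsFractionRing.map, IsLocalization.map_eq]

variable [IsNoetherianRing A] [IsNoetherianRing B]

theorem ord_fractionMap {p : PrimeDivisor A} {q : PrimeDivisor B}
    (h : ∀ a : A, a ≠ 0 → q.ord (algebraMap B (FractionRing B) (algebraMap A B a)) =
      p.ord (algebraMap A (FractionRing A) a)) (g : FractionRing A) :
    q.ord (fractionMap A B g) = p.ord g := by
  rcases eq_or_ne g 0 with rfl | hg
  -- Both sides take the default value `0` at `g = 0`.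
  · simp [ord]
  obtain ⟨a, b, hb, rfl⟩ := IsFractionRing.div_surjective (A := A) g
  have hb0 : b ≠ 0 := nonZeroDivisors.ne_zero hb
  have ha0 : a ≠ 0 := by
    rintro rfl
    simp at hg
  rw [map_div₀, fractionMap_algebraMap, fractionMap_algebraMap,
    ord_div _ (by simpa using ha0) (by simpa using hb0),
    ord_div _ (by simpa using ha0) (by simpa using hb0), h a ha0, h b hb0]

end FractionMap

section LocalizationDiv

variable {A : Type*} [CommRing A] [IsDomain A] [IsNoetherianRing A] (g : A)
  {B : Type*} [CommRing B] [Algebra A B] [IsLocalization.Away g B]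
  [IsDomain B] [IsNoetherianRing B] [FaithfulSMul A B]

theorem _root_.WDiv.restrict_principalDiv (h : (FractionRing A)ˣ) :
    (principalDiv h).restrict g B = principalDiv (Units.map (fractionMap A B).toMonoidHom h) := by
  ext q
  rw [WDiv.restrict_apply, principalDiv_apply, principalDiv_apply]
  exact (ord_fractionMap (fun a ha ↦ q.ord_algebraMap_contract g ha) _).symm

-- Powers of `g` clear the denominators of numerator and denominator, so `U` has no rational
-- functions beyond those of `X`.
omit [IsNoetherianRing A] [IsNoetherianRing B] in
include g in
theorem _root_.fractionMap_surjective_of_away : Function.Surjective (fractionMap A B) := by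
  intro x
  obtain ⟨a, b, hb, rfl⟩ := IsFractionRing.div_surjective (A := B) x
  obtain ⟨n, a', ha⟩ := IsLocalization.Away.surj g a
  obtain ⟨m, b', hb'⟩ := IsLocalization.Away.surj g b
  have hg (k : ℕ) : algebraMap B (FractionRing B) (algebraMap A B g ^ k) ≠ 0 :=
    (((IsLocalization.Away.algebraMap_isUnit g).pow k).map (algebraMap B (FractionRing B))).ne_zero
  have hbB : algebraMap B (FractionRing B) b ≠ 0 := by
    simpa using nonZeroDivisors.ne_zero hb
  refine ⟨algebraMap A _ (a' * g ^ m) / algebraMap A _ (b' * g ^ n), ?_⟩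
  rw [map_div₀, fractionMap_algebraMap, fractionMap_algebraMap]
  simp only [map_mul (algebraMap A B), map_pow (algebraMap A B), ← ha, ← hb']
  simp only [map_mul (algebraMap B _)]
  rw [div_eq_div_iff (mul_ne_zero (mul_ne_zero hbB (hg m)) (hg n)) hbB]
  ring

end LocalizationDiv

end PrimeDivisor

/-! ### Polynomials over a domain, studied over its field of fractions. -/

section Generic

variable {R : Type*} [CommRing R] [IsDomain R]

open Polynomial in
theorem Polynomial.exists_map_eq_C_mul (F : (FractionRing R)[X]) :
    ∃ b : R, b ≠ 0 ∧ ∃ P : R[X],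
      P.map (algebraMap R (FractionRing R)) = C (algebraMap R (FractionRing R) b) * F := by
  obtain ⟨b, hb, h⟩ := IsLocalization.integerNormalization_spec (nonZeroDivisors R) F
  refine ⟨b, nonZeroDivisors.ne_zero hb, _, h.trans ?_⟩
  rw [← Polynomial.smul_eq_C_mul, algebraMap_smul]

/-- An ideal of polynomials becomes principal over the field of fractions. -/
theorem Polynomial.exists_generic_generator (I : Ideal (Polynomial R)) (hI : I ≠ ⊥) :
    ∃ h ∈ I, ∀ x ∈ I, ∃ b : R, b ≠ 0 ∧ h ∣ Polynomial.C b * x := by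
  -- The generator is a nonzero element of least degree in `I`.
  have hex : ∃ n, ∃ h ∈ I, h ≠ 0 ∧ h.natDegree = n := by
    obtain ⟨h, hI, h0⟩ := Submodule.exists_mem_ne_zero_of_ne_bot hI
    exact ⟨_, h, hI, h0, rfl⟩
  classical
  obtain ⟨h, hhI, h0, hn⟩ := Nat.find_spec hex
  have hmin : ∀ r ∈ I, r.natDegree < h.natDegree → r = 0 := by
    intro r hr hlt
    by_contra hr0
    exact Nat.find_min hex (hn ▸ hlt) ⟨r, hr, hr0, rfl⟩
  refine ⟨h, hhI, fun x hx ↦ ?_⟩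
  let φ := algebraMap R (FractionRing R)
  have hφ : Function.Injective φ := IsFractionRing.injective R _
  -- Division with remainder over the field of fractions: `b` clears the denominators of the
  -- quotient, and the remainder scaled by `b` then has coefficients in `R`, lies in `I` and must
  -- vanish by minimality.
  obtain ⟨b, hb, Q, hQ⟩ := Polynomial.exists_map_eq_C_mul (x.map φ / h.map φ)
  refine ⟨b, hb, Q, ?_⟩
  have hmap : (Polynomial.C b * x - h * Q).map φ =
      Polynomial.C (φ b) * (x.map φ % h.map φ) := by
    have := EuclideanDomain.div_add_mod (x.map φ) (h.map φ)
    rw [Polynomial.map_sub, Polynomial.map_mul, Polynomial.map_mul, hQ, Polynomial.map_C]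
    linear_combination - Polynomial.C (φ b) * this
  have hdeg : (Polynomial.C b * x - h * Q).degree < h.degree := by
    rw [← Polynomial.degree_map_eq_of_injective hφ, hmap,
      Polynomial.degree_C_mul ((map_ne_zero_iff φ hφ).2 hb),
      ← Polynomial.degree_map_eq_of_injective hφ h]
    exact EuclideanDomain.mod_lt _ ((Polynomial.map_ne_zero_iff hφ).2 h0)
  have hrI : Polynomial.C b * x - h * Q ∈ I :=
    I.sub_mem (I.mul_mem_left _ hx) (I.mul_mem_right _ hhI)
  by_contra hne
  have hr0 : Polynomial.C b * x - h * Q ≠ 0 := sub_ne_zero.2 hne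
  exact hr0 (hmin _ hrI (Polynomial.natDegree_lt_natDegree hr0 hdeg))

/-- Over the field of fractions `c` is a unit and `X` is prime, so a divisor is associated to a
power of `X`. -/
theorem Polynomial.eq_C_mul_X_pow_of_dvd {P : Polynomial R} {c : R} {n : ℕ} (hc : c ≠ 0)
    (h : P ∣ Polynomial.C c * Polynomial.X ^ n) :
    ∃ (a : R) (i : ℕ), P = Polynomial.C a * Polynomial.X ^ i := by
  let φ := algebraMap R (FractionRing R)
  have hφ : Function.Injective φ := IsFractionRing.injective R _
  have hc' : IsUnit (Polynomial.C (φ c)) :=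
    Polynomial.isUnit_C.2 (isUnit_iff_ne_zero.2 ((map_ne_zero_iff φ hφ).2 hc))
  have h1 := Polynomial.map_dvd φ h
  rw [Polynomial.map_mul, Polynomial.map_C, Polynomial.map_pow, Polynomial.map_X,
    hc'.dvd_mul_left, dvd_prime_pow Polynomial.prime_X] at h1
  obtain ⟨i, -, hi⟩ := h1
  obtain ⟨w, hw⟩ := hi.symm
  obtain ⟨k, -, hk⟩ := Polynomial.isUnit_iff.1 w.isUnit
  refine ⟨P.coeff i, i, Polynomial.map_injective φ hφ ?_⟩
  rw [← hk, mul_comm] at hw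
  have : φ (P.coeff i) = k := by
    rw [← Polynomial.coeff_map, ← hw, Polynomial.coeff_C_mul_X_pow, if_pos rfl]
  rw [Polynomial.map_mul, Polynomial.map_C, this, Polynomial.map_pow, Polynomial.map_X, hw]

/-- Two polynomials, after cancelling their greatest common divisor over the field of fractions. -/
theorem Polynomial.exists_coprime_quotient {P Q : Polynomial R} (hP : P ≠ 0) (hQ : Q ≠ 0) :
    ∃ (P' Q' U V : Polynomial R) (a b r : R), P' ≠ 0 ∧ Q' ≠ 0 ∧ a ≠ 0 ∧ b ≠ 0 ∧ r ≠ 0 ∧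
      Polynomial.C b * P * Q' = Polynomial.C a * Q * P' ∧ U * P' + V * Q' = Polynomial.C r := by
  classical
  let φ := algebraMap R (FractionRing R)
  have hφ : Function.Injective φ := IsFractionRing.injective R _
  have hp : P.map φ ≠ 0 := (Polynomial.map_ne_zero_iff hφ).2 hP
  have hq : Q.map φ ≠ 0 := (Polynomial.map_ne_zero_iff hφ).2 hQ
  obtain ⟨p, hpd⟩ := EuclideanDomain.gcd_dvd_left (P.map φ) (Q.map φ)
  obtain ⟨q, hqd⟩ := EuclideanDomain.gcd_dvd_right (P.map φ) (Q.map φ)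
  have hbez := EuclideanDomain.gcd_eq_gcd_ab (P.map φ) (Q.map φ)
  set d := EuclideanDomain.gcd (P.map φ) (Q.map φ)
  set x := EuclideanDomain.gcdA (P.map φ) (Q.map φ)
  set y := EuclideanDomain.gcdB (P.map φ) (Q.map φ)
  have hd : d ≠ 0 := fun h ↦ hp (by rw [hpd, h, zero_mul])
  have hp0 : p ≠ 0 := fun h ↦ hp (by rw [hpd, h, mul_zero])
  have hq0 : q ≠ 0 := fun h ↦ hq (by rw [hqd, h, mul_zero])
  have hxy : p * x + q * y = 1 := by
    apply mul_left_cancel₀ hd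
    linear_combination -hbez - x * hpd - y * hqd
  obtain ⟨b₁, hb₁, P', hP'⟩ := Polynomial.exists_map_eq_C_mul p
  obtain ⟨b₂, hb₂, Q', hQ'⟩ := Polynomial.exists_map_eq_C_mul q
  obtain ⟨b₃, hb₃, U, hU⟩ := Polynomial.exists_map_eq_C_mul x
  obtain ⟨b₄, hb₄, V, hV⟩ := Polynomial.exists_map_eq_C_mul y
  have hne {b : R} {F : Polynomial R} {G : Polynomial (FractionRing R)} (hb : b ≠ 0) (hG : G ≠ 0)
      (h : F.map φ = Polynomial.C (φ b) * G) : F ≠ 0 := by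
    rintro rfl
    rw [Polynomial.map_zero, eq_comm, mul_eq_zero, Polynomial.C_eq_zero] at h
    exact h.elim (fun h ↦ hb (hφ (by rw [h, map_zero]))) hG
  -- The factors on `U` and `V` bring both terms of the Bézout relation `hxy` to the common
  -- multiplier `b₁ * b₂ * b₃ * b₄`.
  refine ⟨P', Q', Polynomial.C (b₂ * b₄) * U, Polynomial.C (b₁ * b₃) * V, b₂, b₁,
    b₁ * b₂ * b₃ * b₄, hne hb₁ hp0 hP', hne hb₂ hq0 hQ', hb₂, hb₁, by positivity,
    Polynomial.map_injective φ hφ ?_, Polynomial.map_injective φ hφ ?_⟩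
  · simp only [Polynomial.map_mul, Polynomial.map_C]
    rw [hP', hQ', hpd, hqd]
    ring
  · simp only [Polynomial.map_mul, Polynomial.map_C, Polynomial.map_add, map_mul]
    rw [hP', hQ', hU, hV]
    linear_combination Polynomial.C (φ b₁) * Polynomial.C (φ b₂) * Polynomial.C (φ b₃) *
      Polynomial.C (φ b₄) * hxy

end Generic

/-! ### Divisors and rational functions on `𝔸¹_* × Y`. -/

section Cylinder

variable {R : Type*} [CommRing R]

theorem LaurentPolynomial.algebraMap_eq_toLaurent_C (c : R) :
    algebraMap R R[T;T⁻¹] c = Polynomial.toLaurent (Polynomial.C c) := by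
  rw [Polynomial.toLaurent_C]
  rfl

theorem LaurentPolynomial.algebraMap_ne_zero {c : R} (hc : c ≠ 0) :
    algebraMap R R[T;T⁻¹] c ≠ 0 := by
  rw [algebraMap_eq_toLaurent_C]
  exact Polynomial.toLaurent_ne_zero.2 (Polynomial.C_ne_zero.2 hc)

theorem LaurentPolynomial.dvd_T_mul {x y : R[T;T⁻¹]} {n : ℤ} :
    x ∣ LaurentPolynomial.T n * y ↔ x ∣ y :=
  (LaurentPolynomial.isUnit_T n).dvd_mul_left

variable [IsDomain R] [IsNoetherianRing R]

namespace PrimeDivisor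

theorem comap_cylinder (p : PrimeDivisor R) :
    p.cylinder.asIdeal.comap (algebraMap R R[T;T⁻¹]) = p.asIdeal :=
  comap_map_laurentPolynomial p.asIdeal

theorem cylinder_injective :
    Function.Injective (cylinder : PrimeDivisor R → PrimeDivisor R[T;T⁻¹]) := by
  intro p q h
  ext1
  rw [← p.comap_cylinder, ← q.comap_cylinder, h]

/-- The contraction of `q` contains a prime divisor of `R`, whose cylinder lies in `q` and so equals
it, both having height one. Thus the prime divisors that are not cylinders are exactly those on
which no nonzero function of `Y` vanishes. -/
theorem mem_range_cylinder {q : PrimeDivisor R[T;T⁻¹]} {a : R} (ha : a ≠ 0)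
    (haq : algebraMap R R[T;T⁻¹] a ∈ q.asIdeal) : q ∈ Set.range cylinder := by
  obtain ⟨p, -, hpq⟩ := exists_le_of_mem (q := q.asIdeal.comap (algebraMap R R[T;T⁻¹])) ha haq
  exact ⟨p, PrimeDivisor.ext
    (q.eq_of_le p.cylinder.asIdeal_ne_bot (Ideal.map_le_iff_le_comap.2 hpq))⟩

theorem ord_algebraMap_of_notMem_range_cylinder {q : PrimeDivisor R[T;T⁻¹]}
    (hq : q ∉ Set.range cylinder) {a : R} (ha : a ≠ 0) :
    q.ord (algebraMap R[T;T⁻¹] (FractionRing R[T;T⁻¹]) (algebraMap R R[T;T⁻¹] a)) = 0 :=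
  q.ord_algebraMap_eq_zero fun h ↦ hq (mem_range_cylinder ha h)

theorem ord_T (q : PrimeDivisor R[T;T⁻¹]) (n : ℤ) :
    q.ord (algebraMap R[T;T⁻¹] (FractionRing R[T;T⁻¹]) (LaurentPolynomial.T n)) = 0 :=
  q.ord_algebraMap_eq_zero fun h ↦
    q.isPrime.ne_top (Ideal.eq_top_of_isUnit_mem _ h (LaurentPolynomial.isUnit_T n))

theorem ord_fractionMap_of_notMem_range_cylinder {q : PrimeDivisor R[T;T⁻¹]}
    (hq : q ∉ Set.range cylinder) {g : FractionRing R} (hg : g ≠ 0) :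
    q.ord (fractionMap R R[T;T⁻¹] g) = 0 := by
  obtain ⟨a, b, hb, rfl⟩ := IsFractionRing.div_surjective (A := R) g
  have hb0 : b ≠ 0 := nonZeroDivisors.ne_zero hb
  have ha0 : a ≠ 0 := by
    rintro rfl
    simp at hg
  rw [map_div₀, fractionMap_algebraMap, fractionMap_algebraMap,
    ord_div _ (by simpa using! LaurentPolynomial.algebraMap_ne_zero ha0)
      (by simpa using! LaurentPolynomial.algebraMap_ne_zero hb0),
    ord_algebraMap_of_notMem_range_cylinder hq ha0,
    ord_algebraMap_of_notMem_range_cylinder hq hb0, sub_zero]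

/-- The ideal of the cylinder is by construction the extension of `p`, so the comparison of orders
applies with multiplier `1`. -/
theorem ord_cylinder [IsIntegrallyClosed R] (p : PrimeDivisor R) (g : FractionRing R) :
    p.cylinder.ord (fractionMap R R[T;T⁻¹] g) = p.ord g :=
  ord_fractionMap (fun _ ha ↦ p.ord_algebraMap_of_unramified p.cylinder p.comap_cylinder
    (fun x hx ↦ ⟨1, p.cylinder.asIdeal.one_notMem, by rw [one_mul]; exact hx⟩) ha) g

-- A power of the unit `T` moves any Laurent polynomial into `R[X]`, which reduces the claim to
-- `Polynomial.exists_generic_generator`.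
omit [IsNoetherianRing R] in
theorem exists_generic_generator (q : PrimeDivisor R[T;T⁻¹]) :
    ∃ h ∈ q.asIdeal, ∀ x ∈ q.asIdeal, ∃ b : R, b ≠ 0 ∧ h ∣ algebraMap R R[T;T⁻¹] b * x := by
  let I : Ideal (Polynomial R) := q.asIdeal.comap Polynomial.toLaurent
  have key : ∀ x ∈ q.asIdeal, ∃ (n : ℕ) (P : Polynomial R), P ∈ I ∧
      Polynomial.toLaurent P = LaurentPolynomial.T n * x := by
    intro x hx
    obtain ⟨n, P, hP⟩ := x.exists_T_pow
    rw [mul_comm] at hP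
    exact ⟨n, P, by rw [Ideal.mem_comap, hP]; exact q.asIdeal.mul_mem_left _ hx, hP⟩
  have hI : I ≠ ⊥ := by
    obtain ⟨x, hx, hx0⟩ := q.exists_mem_asIdeal
    obtain ⟨n, P, hPI, hP⟩ := key x hx
    rw [Submodule.ne_bot_iff]
    refine ⟨P, hPI, ?_⟩
    rintro rfl
    rw [map_zero, eq_comm, (LaurentPolynomial.isUnit_T (n : ℤ)).mul_right_eq_zero] at hP
    exact hx0 hP
  obtain ⟨h, hhI, hh⟩ := Polynomial.exists_generic_generator I hI
  refine ⟨Polynomial.toLaurent h, hhI, fun x hx ↦ ?_⟩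
  obtain ⟨n, P, hPI, hP⟩ := key x hx
  obtain ⟨b, hb, hdvd⟩ := hh P hPI
  refine ⟨b, hb, ?_⟩
  have := map_dvd Polynomial.toLaurent hdvd
  rwa [map_mul, hP, mul_left_comm, LaurentPolynomial.dvd_T_mul,
    ← LaurentPolynomial.algebraMap_eq_toLaurent_C] at this

/-- A prime divisor on `𝔸¹_* × Y` dominating `Y` is principal up to cylinders. -/
theorem exists_principalDiv_sub_single {q : PrimeDivisor R[T;T⁻¹]} (hq : q ∉ Set.range cylinder) :
    ∃ h : (FractionRing R[T;T⁻¹])ˣ, ∀ q' ∉ Set.range cylinder,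
      principalDiv h q' = (Finsupp.single q 1 : WDiv R[T;T⁻¹]) q' := by
  classical
  -- The multipliers `b` lie in no prime divisor other than cylinders. Hence `h` generates `q`
  -- locally at `q`, and any other such divisor on which `h` vanishes contains `q`.
  obtain ⟨h, hhq, hh⟩ := exists_generic_generator q
  have h0 : h ≠ 0 := by
    rintro rfl
    obtain ⟨x, hx, hx0⟩ := q.exists_mem_asIdeal
    obtain ⟨b, hb, hbx⟩ := hh x hx
    rw [zero_dvd_iff, mul_eq_zero] at hbx
    exact hbx.elim (LaurentPolynomial.algebraMap_ne_zero hb) hx0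
  have : NeZero h := ⟨h0⟩
  refine ⟨regularUnit h, fun q' hq' ↦ ?_⟩
  rw [principalDiv_apply, Finsupp.single_apply]
  change q'.ord (algebraMap _ _ h) = _
  split_ifs with hqq
  · subst hqq
    refine q.ord_eq_one hhq fun x hx ↦ ?_
    obtain ⟨b, hb, hbx⟩ := hh x hx
    exact ⟨_, fun hbq ↦ hq (mem_range_cylinder hb hbq), hbx⟩
  · refine q'.ord_algebraMap_eq_zero fun hhq' ↦ hqq (PrimeDivisor.ext ?_)
    refine q'.eq_of_le q.asIdeal_ne_bot fun x hx ↦ ?_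
    obtain ⟨b, hb, hbx⟩ := hh x hx
    exact (q'.isPrime.mem_or_mem (q'.asIdeal.mem_of_dvd hbx hhq')).resolve_left
      fun hbq ↦ hq' (mem_range_cylinder hb hbq)

/-- Over the generic point of `Y` such a `P` is a unit of the Laurent ring, and the units there are
monomials. -/
theorem exists_eq_C_mul_X_pow_of_forall_notMem {P : Polynomial R} (hP : P ≠ 0)
    (h : ∀ q : PrimeDivisor R[T;T⁻¹], q ∉ Set.range cylinder →
      Polynomial.toLaurent P ∉ q.asIdeal) :
    ∃ (c : R) (i : ℕ), P = Polynomial.C c * Polynomial.X ^ i := by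
  have hP' : Polynomial.toLaurent P ≠ 0 := (Polynomial.toLaurent_ne_zero).2 hP
  -- Otherwise some prime contains `P` and avoids the nonzero elements of `R`; a prime divisor
  -- inside it containing `P` cannot be a cylinder.
  have hM : ¬ Disjoint (Ideal.span {Polynomial.toLaurent P} : Set R[T;T⁻¹])
      ((nonZeroDivisors R).map (algebraMap R R[T;T⁻¹]) : Set R[T;T⁻¹]) := by
    intro hdisj
    obtain ⟨q, hq, hle, hdis⟩ := Ideal.exists_le_prime_disjoint _ _ hdisj
    obtain ⟨p, hPp, hpq⟩ := exists_le_of_mem hP' ((Ideal.span_singleton_le_iff_mem q).1 hle)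
    refine h p ?_ hPp
    rintro ⟨p', rfl⟩
    obtain ⟨a, hap, ha⟩ := p'.exists_mem_asIdeal
    exact Set.disjoint_left.1 hdis (hpq (Ideal.mem_map_of_mem _ hap))
      ⟨a, mem_nonZeroDivisors_of_ne_zero ha, rfl⟩
  obtain ⟨_, hx, c, hc, rfl⟩ := Set.not_disjoint_iff.1 hM
  obtain ⟨y, hy⟩ := Ideal.mem_span_singleton.1 hx
  obtain ⟨n, Y, hY⟩ := y.exists_T_pow
  refine Polynomial.eq_C_mul_X_pow_of_dvd (c := c) (n := n) (nonZeroDivisors.ne_zero hc)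
    ⟨Y, Polynomial.toLaurent_injective ?_⟩
  rw [map_mul, map_mul, hY, ← LaurentPolynomial.algebraMap_eq_toLaurent_C, ← mul_assoc, ← hy,
    Polynomial.toLaurent_X_pow]

/-- A rational function on `𝔸¹_* × Y` without zeros and poles on the generic fibre over `Y`
is a rational function on `Y` times a power of the coordinate. -/
theorem exists_eq_fractionMap_mul_zpow {g : FractionRing R[T;T⁻¹]} (hg : g ≠ 0)
    (h : ∀ q : PrimeDivisor R[T;T⁻¹], q ∉ Set.range cylinder → q.ord g = 0) :
    ∃ (c : FractionRing R) (n : ℤ), c ≠ 0 ∧ g = fractionMap R R[T;T⁻¹] c *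
      algebraMap R[T;T⁻¹] (FractionRing R[T;T⁻¹]) (LaurentPolynomial.T 1) ^ n := by
  let B := R[T;T⁻¹]
  let ι : B →+* FractionRing B := algebraMap B (FractionRing B)
  have hι : Function.Injective ι := IsFractionRing.injective B _
  have hL {P : Polynomial R} (hP : P ≠ 0) : ι (Polynomial.toLaurent P) ≠ 0 :=
    (map_ne_zero_iff ι hι).2 (Polynomial.toLaurent_ne_zero.2 hP)
  have hC {a : R} (ha : a ≠ 0) : ι (algebraMap R B a) ≠ 0 := by
    rw [LaurentPolynomial.algebraMap_eq_toLaurent_C]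
    exact hL (Polynomial.C_ne_zero.2 ha)
  have hT (n : ℤ) : ι (LaurentPolynomial.T n) ≠ 0 :=
    ((LaurentPolynomial.isUnit_T n).map ι).ne_zero
  have hTn (n : ℕ) : ι (LaurentPolynomial.T n) = ι (LaurentPolynomial.T 1) ^ n := by
    rw [← map_pow, LaurentPolynomial.T_pow, mul_one]
  obtain ⟨x, y, hy, rfl⟩ := IsFractionRing.div_surjective (A := B) g
  have hy0 : y ≠ 0 := nonZeroDivisors.ne_zero hy
  have hx0 : x ≠ 0 := by
    rintro rfl
    simp at hg
  obtain ⟨m, P, hP⟩ := x.exists_T_pow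
  obtain ⟨n, Q, hQ⟩ := y.exists_T_pow
  have hP0 : P ≠ 0 := by
    rintro rfl
    rw [map_zero, eq_comm, (LaurentPolynomial.isUnit_T (m : ℤ)).mul_left_eq_zero] at hP
    exact hx0 hP
  have hQ0 : Q ≠ 0 := by
    rintro rfl
    rw [map_zero, eq_comm, (LaurentPolynomial.isUnit_T (n : ℤ)).mul_left_eq_zero] at hQ
    exact hy0 hQ
  -- Once the fraction is reduced, a common zero divisor of `P'` and `Q'` contains the nonzero
  -- constant `r` and is a cylinder. Off the cylinders their orders agree because `g` has order `0`,
  -- so neither vanishes there and both are monomials.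
  obtain ⟨P', Q', U, V, a, b, r, hP'0, hQ'0, ha, hb, hr, hPQ, hUV⟩ :=
    Polynomial.exists_coprime_quotient hP0 hQ0
  have hfrac : ι x / ι y = (ι (algebraMap R B a) / ι (algebraMap R B b)) *
      (ι (Polynomial.toLaurent P') / ι (Polynomial.toLaurent Q')) *
      (ι (LaurentPolynomial.T n) / ι (LaurentPolynomial.T m)) := by
    have e := congrArg (fun F ↦ ι (Polynomial.toLaurent F)) hPQ
    simp only [map_mul, ← LaurentPolynomial.algebraMap_eq_toLaurent_C, hP, hQ] at e
    have hyK : ι y ≠ 0 := (map_ne_zero_iff ι hι).2 hy0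
    rw [div_mul_div_comm, div_mul_div_comm,
      div_eq_div_iff hyK (mul_ne_zero (mul_ne_zero (hC hb) (hL hQ'0)) (hT m))]
    linear_combination e
  have hord (q : PrimeDivisor B) (hq : q ∉ Set.range cylinder) :
      q.ord (ι (Polynomial.toLaurent P')) = q.ord (ι (Polynomial.toLaurent Q')) := by
    have := h q hq
    rw [hfrac, q.ord_mul (by simp [hC ha, hC hb, hL hP'0, hL hQ'0]) (by simp [hT]),
      q.ord_mul (by simp [hC ha, hC hb]) (by simp [hL hP'0, hL hQ'0]),
      q.ord_div (hC ha) (hC hb), q.ord_div (hL hP'0) (hL hQ'0), q.ord_div (hT n) (hT m),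
      ord_T, ord_T, ord_algebraMap_of_notMem_range_cylinder hq ha,
      ord_algebraMap_of_notMem_range_cylinder hq hb] at this
    linarith
  have hcop (q : PrimeDivisor B) (hq : q ∉ Set.range cylinder)
      (h1 : Polynomial.toLaurent P' ∈ q.asIdeal) (h2 : Polynomial.toLaurent Q' ∈ q.asIdeal) :
      False := by
    refine hq (mem_range_cylinder hr ?_)
    rw [LaurentPolynomial.algebraMap_eq_toLaurent_C, ← hUV, map_add, map_mul, map_mul]
    exact add_mem (q.asIdeal.mul_mem_left _ h1) (q.asIdeal.mul_mem_left _ h2)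
  have hmem {F : Polynomial R} (hF : F ≠ 0) (q : PrimeDivisor B) :
      Polynomial.toLaurent F ∈ q.asIdeal ↔ q.ord (ι (Polynomial.toLaurent F)) ≠ 0 :=
    ⟨fun hFq ↦ (q.ord_algebraMap_pos (Polynomial.toLaurent_ne_zero.2 hF) hFq).ne',
      fun hF0 ↦ by_contra fun hFq ↦ hF0 (q.ord_algebraMap_eq_zero hFq)⟩
  have hboth (q : PrimeDivisor B) (hq : q ∉ Set.range cylinder) :
      Polynomial.toLaurent P' ∈ q.asIdeal ↔ Polynomial.toLaurent Q' ∈ q.asIdeal := by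
    rw [hmem hP'0, hmem hQ'0, hord q hq]
  obtain ⟨c, i, rfl⟩ := exists_eq_C_mul_X_pow_of_forall_notMem hP'0
    fun q hq h1 ↦ hcop q hq h1 ((hboth q hq).1 h1)
  obtain ⟨d, j, rfl⟩ := exists_eq_C_mul_X_pow_of_forall_notMem hQ'0
    fun q hq h2 ↦ hcop q hq ((hboth q hq).2 h2) h2
  have hc : c ≠ 0 := by
    rintro rfl
    simp at hP'0
  have hd : d ≠ 0 := by
    rintro rfl
    simp at hQ'0
  have hmono (c : R) (i : ℕ) : ι (Polynomial.toLaurent (Polynomial.C c * Polynomial.X ^ i)) =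
      ι (algebraMap R B c) * ι (LaurentPolynomial.T 1) ^ i := by
    rw [map_mul, map_mul, Polynomial.toLaurent_X_pow, hTn,
      LaurentPolynomial.algebraMap_eq_toLaurent_C]
  have hfm : fractionMap R B (algebraMap R _ (a * c) / algebraMap R _ (b * d)) =
      ι (algebraMap R B a) * ι (algebraMap R B c) /
        (ι (algebraMap R B b) * ι (algebraMap R B d)) := by
    rw [map_div₀, fractionMap_algebraMap, fractionMap_algebraMap, map_mul, map_mul, map_mul,
      map_mul]
  have hcancel {k : Type _} [Field k] (a b c d t : k) (ht : t ≠ 0) :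
      a / b * (c * t ^ i / (d * t ^ j)) * (t ^ n / t ^ m) =
        a * c / (b * d) * t ^ ((i + n : ℤ) - (j + m : ℤ)) := by
    rw [zpow_sub₀ ht, zpow_add₀ ht, zpow_add₀ ht, zpow_natCast, zpow_natCast, zpow_natCast,
      zpow_natCast]
    simp only [div_mul_div_comm]
    congr 1 <;> ring
  refine ⟨algebraMap R _ (a * c) / algebraMap R _ (b * d), (i + n : ℤ) - (j + m : ℤ), ?_, ?_⟩
  · simp [ha, hb, hc, hd]
  · rw [hfm, hfrac, hmono, hmono, hTn, hTn]
    exact hcancel _ _ _ _ _ (hT 1)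

end PrimeDivisor

namespace WDiv

theorem cylinder_apply (Z : WDiv R) (p : PrimeDivisor R) : Z.cylinder p.cylinder = Z p :=
  Finsupp.mapDomain_apply PrimeDivisor.cylinder_injective _ _

theorem cylinder_apply_of_notMem_range (Z : WDiv R) {q : PrimeDivisor R[T;T⁻¹]}
    (hq : q ∉ Set.range PrimeDivisor.cylinder) : Z.cylinder q = 0 :=
  Finsupp.mapDomain_of_notMem_range _ _ hq

theorem cylinder_injective : Function.Injective (WDiv.cylinder : WDiv R → WDiv R[T;T⁻¹]) :=
  Finsupp.mapDomain_injective PrimeDivisor.cylinder_injective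

theorem exists_cylinder_eq {Z : WDiv R[T;T⁻¹]}
    (hZ : ∀ q ∉ Set.range PrimeDivisor.cylinder, Z q = 0) : ∃ W : WDiv R, W.cylinder = Z := by
  refine ⟨Finsupp.comapDomain PrimeDivisor.cylinder Z PrimeDivisor.cylinder_injective.injOn,
    Finsupp.mapDomain_comapDomain _ PrimeDivisor.cylinder_injective _ fun q hq ↦ ?_⟩
  by_contra h
  exact Finsupp.mem_support_iff.1 hq (hZ q h)

theorem cylinder_principalDiv [IsIntegrallyClosed R] (g : (FractionRing R)ˣ) :
    (principalDiv g).cylinder =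
      principalDiv (Units.map (fractionMap R R[T;T⁻¹]).toMonoidHom g) := by
  ext q
  rw [principalDiv_apply]
  by_cases hq : q ∈ Set.range PrimeDivisor.cylinder
  · obtain ⟨p, rfl⟩ := hq
    rw [cylinder_apply, principalDiv_apply]
    exact (p.ord_cylinder _).symm
  · rw [cylinder_apply_of_notMem_range _ hq]
    exact (PrimeDivisor.ord_fractionMap_of_notMem_range_cylinder hq g.ne_zero).symm

/-- Every Weil divisor on `𝔸¹_* × Y` is linearly equivalent to a cylinder. -/
theorem exists_cylinder_add_principalDiv (Z : WDiv R[T;T⁻¹]) :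
    ∃ (W : WDiv R) (g : (FractionRing R[T;T⁻¹])ˣ), Z = W.cylinder + principalDiv g := by
  -- It is enough to match coefficients off the cylinders; what is left is itself a cylinder.
  suffices h : ∃ g : Additive (FractionRing R[T;T⁻¹])ˣ,
      ∀ q ∉ Set.range PrimeDivisor.cylinder, Z q = principalDivHom R[T;T⁻¹] g q by
    obtain ⟨g, hg⟩ := h
    obtain ⟨W, hW⟩ := exists_cylinder_eq (Z := Z - principalDivHom R[T;T⁻¹] g)
      fun q hq ↦ by rw [Finsupp.sub_apply, hg q hq, sub_self]
    exact ⟨W, g.toMul, by rw [hW]; exact (sub_add_cancel Z _).symm⟩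
  induction Z using Finsupp.induction_linear with
  | zero => exact ⟨0, fun q _ ↦ by rw [map_zero]⟩
  | add Z Z' h h' =>
    obtain ⟨g, hg⟩ := h
    obtain ⟨g', hg'⟩ := h'
    exact ⟨g + g', fun q hq ↦ by
      rw [map_add, Finsupp.add_apply, Finsupp.add_apply, hg q hq, hg' q hq]⟩
  | single q n =>
    by_cases hq : q ∈ Set.range PrimeDivisor.cylinder
    · refine ⟨0, fun q' hq' ↦ ?_⟩
      rw [map_zero, Finsupp.single_eq_of_ne (by rintro rfl; exact hq' hq)]
      rfl
    · obtain ⟨g, hg⟩ := PrimeDivisor.exists_principalDiv_sub_single hq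
      refine ⟨n • Additive.ofMul g, fun q' hq' ↦ ?_⟩
      have h1 : principalDivHom R[T;T⁻¹] (Additive.ofMul g) q' =
        (Finsupp.single q 1 : WDiv R[T;T⁻¹]) q' := hg q' hq'
      rw [map_zsmul, Finsupp.smul_apply, h1, ← Finsupp.smul_apply, Finsupp.smul_single,
        smul_eq_mul, mul_one]

end WDiv

end Cylinder

theorem fractionMap_fractionMap {A B C : Type*} [CommRing A] [IsDomain A] [CommRing B] [IsDomain B]
    [CommRing C] [IsDomain C] [Algebra A B] [Algebra B C] [Algebra A C] [IsScalarTower A B C]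
    [FaithfulSMul A B] [FaithfulSMul B C] [FaithfulSMul A C] (g : FractionRing A) :
    fractionMap B C (fractionMap A B g) = fractionMap A C g := by
  obtain ⟨a, b, hb, rfl⟩ := IsFractionRing.div_surjective (A := A) g
  simp only [map_div₀, fractionMap_algebraMap]
  rw [← IsScalarTower.algebraMap_apply A B C, ← IsScalarTower.algebraMap_apply A B C]

/-! ### Prime divisors of the suspension inside `{u = 0}`. -/

namespace SuspRing

variable {R : Type*} [CommRing R] (f : R)

instance isScalarTower_laurent : IsScalarTower R (SuspRing R f) R[T;T⁻¹] :=
  IsScalarTower.of_algebraMap_eq fun r ↦ ((toLaurent f).commutes r).symm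

theorem exists_eq_u_mul_add (x : SuspRing R f) :
    ∃ (y : SuspRing R f) (P : Polynomial R), x = u f * y + Polynomial.aeval (v f) P := by
  obtain ⟨F, rfl⟩ := Ideal.Quotient.mk_surjective x
  induction F using MvPolynomial.induction_on with
  | C a => exact ⟨0, Polynomial.C a, by rw [mul_zero, zero_add, Polynomial.aeval_C]; rfl⟩
  | add F G hF hG =>
    obtain ⟨y, P, hP⟩ := hF
    obtain ⟨z, Q, hQ⟩ := hG
    exact ⟨y + z, P + Q, by rw [map_add, hP, hQ, map_add]; ring⟩
  | mul_X F i hF =>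
    obtain ⟨y, P, hP⟩ := hF
    fin_cases i
    · refine ⟨Ideal.Quotient.mk _ F, 0, ?_⟩
      rw [map_zero, add_zero, mul_comm (u f), map_mul]
      rfl
    · refine ⟨y * v f, P * Polynomial.X, ?_⟩
      simp only [map_mul, Polynomial.aeval_X, hP]
      change _ * v f = _
      ring

/-- The ideal `(u) + p` of the suspension, for an ideal `p` of the base. -/
noncomputable def idealOver (p : Ideal R) : Ideal (SuspRing R f) :=
  Ideal.span {u f} ⊔ p.map (algebraMap R (SuspRing R f))

theorem u_mem_idealOver (p : Ideal R) : u f ∈ idealOver f p :=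
  Ideal.mem_sup_left (Ideal.mem_span_singleton_self _)

/-- Since `u v = f ∈ p`, multiplication by `v` absorbs the generator `u`. As `v` is invertible at
the generic point of `𝔸¹ × E`, the ideal `p` alone generates the divisor locally there. -/
theorem v_mul_mem {p : Ideal R} (hf : f ∈ p) {x : SuspRing R f} (hx : x ∈ idealOver f p) :
    v f * x ∈ p.map (algebraMap R (SuspRing R f)) := by
  obtain ⟨y, hy, z, hz, rfl⟩ := Submodule.mem_sup.1 hx
  obtain ⟨w, rfl⟩ := Ideal.mem_span_singleton.1 hy
  rw [mul_add, ← mul_assoc, mul_comm (v f), u_mul_v]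
  exact add_mem (Ideal.mul_mem_right _ _ (Ideal.mem_map_of_mem _ hf)) (Ideal.mul_mem_left _ _ hz)

/-- The restriction of functions on the suspension to the closed subvariety `𝔸¹ × E` of
`{u = 0}`, where `E` is a closed subvariety of `{f = 0}`. -/
noncomputable def toPolynomial {p : Ideal R} (hf : f ∈ p) :
    SuspRing R f →ₐ[R] Polynomial (R ⧸ p) :=
  Ideal.Quotient.liftₐ _ (MvPolynomial.aeval ![0, Polynomial.X]) (by
    intro a ha
    rw [← RingHom.mem_ker]
    refine (Ideal.span_singleton_le_iff_mem _).2 ?_ ha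
    rw [RingHom.mem_ker]
    have : algebraMap R (Polynomial (R ⧸ p)) f = 0 := by
      rw [IsScalarTower.algebraMap_apply R (R ⧸ p) (Polynomial (R ⧸ p)),
        Ideal.Quotient.algebraMap_eq, Ideal.Quotient.eq_zero_iff_mem.2 hf, map_zero]
    simp [this])

variable {f} {p : Ideal R} (hf : f ∈ p)

theorem toPolynomial_u : toPolynomial f hf (u f) = 0 := by
  refine (Ideal.Quotient.lift_mk _ _ _).trans ?_
  simp

theorem toPolynomial_v : toPolynomial f hf (v f) = Polynomial.X := by
  refine (Ideal.Quotient.lift_mk _ _ _).trans ?_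
  simp

theorem toPolynomial_algebraMap (r : R) : toPolynomial f hf (algebraMap R _ r) =
    Polynomial.C (Ideal.Quotient.mk p r) :=
  (toPolynomial f hf).commutes r

/-- Modulo `u` every function is a polynomial in `v`, and it restricts to zero on `𝔸¹ × E` only if
its coefficients lie in `p`. -/
theorem ker_toPolynomial : RingHom.ker (toPolynomial f hf) = idealOver f p := by
  apply le_antisymm
  · intro x hx
    obtain ⟨y, P, rfl⟩ := exists_eq_u_mul_add f x
    rw [RingHom.mem_ker, map_add, map_mul, toPolynomial_u, zero_mul, zero_add,
      ← Polynomial.aeval_algHom_apply, toPolynomial_v] at hx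
    refine add_mem (Ideal.mul_mem_right _ _ (u_mem_idealOver f p)) (Ideal.mem_sup_right ?_)
    have hP : P ∈ p.map (Polynomial.C : R →+* Polynomial R) := by
      rw [Ideal.mem_map_C_iff]
      intro n
      have := congrArg (fun F ↦ F.coeff n) hx
      rw [← Ideal.Quotient.eq_zero_iff_mem]
      simpa [Polynomial.aeval_X_left_eq_map] using! this
    have := Ideal.mem_map_of_mem (Polynomial.aeval (v f) : Polynomial R →ₐ[R] _).toRingHom hP
    rw [Ideal.map_map] at this
    convert! this
    ext r
    exact (Polynomial.aeval_C (v f) r).symm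
  · refine sup_le ?_ (Ideal.map_le_iff_le_comap.2 fun r hr ↦ ?_)
    · rw [Ideal.span_singleton_le_iff_mem, RingHom.mem_ker, toPolynomial_u]
    · rw [Ideal.mem_comap, RingHom.mem_ker, toPolynomial_algebraMap,
        Ideal.Quotient.eq_zero_iff_mem.2 hr, map_zero]

include hf in
theorem isPrime_idealOver [p.IsPrime] : (idealOver f p).IsPrime := by
  rw [← ker_toPolynomial hf]
  exact RingHom.ker_isPrime _

include hf in
theorem comap_idealOver : (idealOver f p).comap (algebraMap R (SuspRing R f)) = p := by
  ext r
  rw [← ker_toPolynomial hf, Ideal.mem_comap, RingHom.mem_ker, toPolynomial_algebraMap,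
    Polynomial.C_eq_zero, Ideal.Quotient.eq_zero_iff_mem]

include hf in
theorem v_notMem_idealOver [p.IsPrime] : v f ∉ idealOver f p := by
  rw [← ker_toPolynomial hf, RingHom.mem_ker, toPolynomial_v]
  exact Polynomial.X_ne_zero

section Domain

variable [IsDomain R] [NeZero f]

theorem u_ne_zero : u f ≠ 0 := nonZeroDivisors.ne_zero (u_mem_nonZeroDivisors f)

omit [IsDomain R] in
theorem v_ne_zero : v f ≠ 0 := by
  intro h
  have h1 := congrArg (toLaurent f) h
  rw [toLaurent_v, map_zero, (LaurentPolynomial.isUnit_T (-1)).mul_left_eq_zero] at h1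
  exact LaurentPolynomial.algebraMap_ne_zero (NeZero.ne f) h1

instance faithfulSMul_laurent : FaithfulSMul (SuspRing R f) R[T;T⁻¹] :=
  (faithfulSMul_iff_algebraMap_injective _ _).2 (toLaurent_injective f)

instance faithfulSMul : @FaithfulSMul R (SuspRing R f) Algebra.toSMul := by
  rw [faithfulSMul_iff_algebraMap_injective]
  have := FaithfulSMul.algebraMap_injective R R[T;T⁻¹]
  rw [IsScalarTower.algebraMap_eq R (SuspRing R f) R[T;T⁻¹], RingHom.coe_comp] at this
  exact Function.Injective.of_comp this

variable [IsNoetherianRing R]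

theorem exists_idealOver_le {q : Ideal (SuspRing R f)} [q.IsPrime] (hq : u f ∈ q) :
    ∃ p : PrimeDivisor R, f ∈ p.asIdeal ∧ idealOver f p.asIdeal ≤ q := by
  have hfq : f ∈ q.comap (algebraMap R (SuspRing R f)) := by
    rw [Ideal.mem_comap, ← u_mul_v]
    exact q.mul_mem_right _ hq
  obtain ⟨p, hfp, hpq⟩ := PrimeDivisor.exists_le_of_mem (NeZero.ne f) hfq
  exact ⟨p, hfp, sup_le ((Ideal.span_singleton_le_iff_mem q).2 hq)
    (Ideal.map_le_iff_le_comap.2 hpq)⟩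

/-- For a prime divisor `E` on `Y` contained in `{f = 0}`, the prime divisor `𝔸¹ × E` on the
suspension, contained in `{u = 0}`. -/
noncomputable def divisorOver (p : PrimeDivisor R) (hf : f ∈ p.asIdeal) :
    PrimeDivisor (SuspRing R f) where
  asIdeal := idealOver f p.asIdeal
  isPrime := isPrime_idealOver hf
  height_eq_one := by
    have := isPrime_idealOver hf
    apply le_antisymm
    · apply Ideal.height_le_one_of_isPrincipal_of_mem_minimalPrimes (Ideal.span {u f})
      refine ⟨⟨inferInstance, (Ideal.span_singleton_le_iff_mem _).2 (u_mem_idealOver f _)⟩, ?_⟩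
      rintro q ⟨hq, huq⟩ hqp
      -- A smaller prime containing `u` contains some `(u) + p'`; contracting to `R` gives `p' ≤ p`,
      -- hence equality by height.
      obtain ⟨p', hfp', hp'q⟩ := exists_idealOver_le ((Ideal.span_singleton_le_iff_mem q).1 huq)
      have hle := Ideal.comap_mono (f := algebraMap R (SuspRing R f)) (hp'q.trans hqp)
      rw [comap_idealOver hfp', comap_idealOver hf] at hle
      rwa [p.eq_of_le p'.asIdeal_ne_bot hle] at hp'q
    · rw [Order.one_le_iff_ne_zero, Ne, Ideal.height_eq_zero_iff,
        IsDomain.minimalPrimes_eq_singleton_bot, Set.mem_singleton_iff]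
      intro h
      have hu := u_mem_idealOver f p.asIdeal
      rw [h, Ideal.mem_bot] at hu
      exact u_ne_zero hu

theorem comap_divisorOver (p : PrimeDivisor R) (hf : f ∈ p.asIdeal) :
    (divisorOver p hf).asIdeal.comap (algebraMap R (SuspRing R f)) = p.asIdeal :=
  comap_idealOver hf

theorem exists_eq_divisorOver {q : PrimeDivisor (SuspRing R f)} (hq : u f ∈ q.asIdeal) :
    ∃ (p : PrimeDivisor R) (hf : f ∈ p.asIdeal), q = divisorOver p hf := by
  obtain ⟨p, hf, hpq⟩ := exists_idealOver_le hq
  exact ⟨p, hf, PrimeDivisor.ext (q.eq_of_le (divisorOver p hf).asIdeal_ne_bot hpq).symm⟩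

variable [IsIntegrallyClosed R]

theorem ord_divisorOver_algebraMap (p : PrimeDivisor R) (hf : f ∈ p.asIdeal) {a : R} (ha : a ≠ 0) :
    (divisorOver p hf).ord (algebraMap _ (FractionRing (SuspRing R f))
      (algebraMap R (SuspRing R f) a)) =
      p.ord (algebraMap R (FractionRing R) a) :=
  p.ord_algebraMap_of_unramified (divisorOver p hf) (comap_divisorOver p hf)
    (fun _ hx ↦ ⟨v f, v_notMem_idealOver hf, v_mul_mem f hf hx⟩) ha

theorem ord_divisorOver (p : PrimeDivisor R) (hf : f ∈ p.asIdeal) (g : FractionRing R) :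
    (divisorOver p hf).ord (fractionMap R (SuspRing R f) g) = p.ord g :=
  PrimeDivisor.ord_fractionMap (fun _ ha ↦ ord_divisorOver_algebraMap p hf ha) g

/-- The function `v` has order `0` along `𝔸¹ × E`, so `u` carries the whole order of `f = u v`. -/
theorem ord_divisorOver_u (p : PrimeDivisor R) (hf : f ∈ p.asIdeal) :
    (divisorOver p hf).ord (algebraMap _ (FractionRing (SuspRing R f)) (u f)) =
      p.ord (algebraMap R (FractionRing R) f) := by
  rw [← ord_divisorOver_algebraMap p hf (NeZero.ne f), ← u_mul_v,
    PrimeDivisor.ord_algebraMap_mul _ u_ne_zero v_ne_zero,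
    (divisorOver p hf).ord_algebraMap_eq_zero (v_notMem_idealOver hf), add_zero]

end Domain

end SuspRing

/-! ### Class groups and the induced homomorphisms. -/

section ClassGroup

variable {A : Type*} [CommRing A] [IsDomain A] [IsNoetherianRing A]

theorem divisorClass_eq_zero_iff {Z : WDiv A} :
    divisorClass Z = 0 ↔ ∃ g : (FractionRing A)ˣ, principalDiv g = Z :=
  (QuotientAddGroup.eq_zero_iff Z).trans Iff.rfl

theorem divisorClass_principalDiv (g : (FractionRing A)ˣ) : divisorClass (principalDiv g) = 0 :=
  divisorClass_eq_zero_iff.2 ⟨g, rfl⟩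

theorem divisorClass_surjective : Function.Surjective (divisorClass : WDiv A → _) :=
  QuotientAddGroup.mk_surjective

theorem divisorClass_sum_smul {ι : Type*} (t : Finset ι) (b : ι → ℤ) (Z : ι → WDiv A) :
    divisorClass (∑ i ∈ t, b i • Z i) = ∑ i ∈ t, b i • divisorClass (Z i) :=
  (map_sum (QuotientAddGroup.mk' (principalDivHom A).range) (fun i ↦ b i • Z i) t).trans
    (Finset.sum_congr rfl fun i _ ↦
      map_zsmul (QuotientAddGroup.mk' (principalDivHom A).range) (b i) (Z i))

omit [IsDomain A] [IsNoetherianRing A] in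
theorem WDiv.sum_smul_single_apply {s : ℕ} {D : Fin s → PrimeDivisor A}
    (hD : Function.Injective D) (b : Fin s → ℤ) (j : Fin s) :
    (∑ i, b i • (Finsupp.single (D i) 1 : WDiv A)) (D j) = b j := by
  classical
  simp [Finsupp.single_apply, hD.eq_iff]

omit [IsDomain A] [IsNoetherianRing A] in
theorem WDiv.sum_smul_single_apply_of_notMem {s : ℕ} {D : Fin s → PrimeDivisor A}
    (b : Fin s → ℤ) {q : PrimeDivisor A} (hq : q ∉ Set.range D) :
    (∑ i, b i • (Finsupp.single (D i) 1 : WDiv A)) q = 0 := by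
  classical
  rw [Finsupp.finsetSum_apply]
  refine Finset.sum_eq_zero fun i _ ↦ ?_
  rw [Finsupp.smul_apply, Finsupp.single_eq_of_ne (by rintro rfl; exact hq ⟨i, rfl⟩), smul_zero]

variable (g : A) (B : Type*) [CommRing B] [Algebra A B] [IsLocalization.Away g B]
  [IsDomain B] [IsNoetherianRing B] [FaithfulSMul A B]

/-- The restriction homomorphism `Cl(X) → Cl(U)` for the principal open subset `U` of `X` given
by `g ≠ 0`. -/
noncomputable def DivisorClassGroup.restrict : DivisorClassGroup A →+ DivisorClassGroup B :=
  QuotientAddGroup.map _ _ (WDiv.restrict g B) (by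
    rintro _ ⟨h, rfl⟩
    exact ⟨_, (WDiv.restrict_principalDiv g h.toMul).symm⟩)

end ClassGroup

section Cylinder

variable (R : Type*) [CommRing R] [IsDomain R] [IsNoetherianRing R] [IsIntegrallyClosed R]

/-- The homomorphism `Cl(Y) → Cl(𝔸¹_* × Y)`. -/
noncomputable def DivisorClassGroup.cylinder :
    DivisorClassGroup R →+ DivisorClassGroup R[T;T⁻¹] :=
  QuotientAddGroup.map _ _ WDiv.cylinder (by
    rintro _ ⟨h, rfl⟩
    exact ⟨_, (WDiv.cylinder_principalDiv h.toMul).symm⟩)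

theorem DivisorClassGroup.cylinder_divisorClass (Z : WDiv R) :
    DivisorClassGroup.cylinder R (divisorClass Z) = divisorClass Z.cylinder := rfl

-- Used for injectivity of `Cl(Y) → Cl(𝔸¹_* × Y)`, and with `Z = 0` for the kernel of `ψ`. The
-- factor `T ^ n` is a unit and does not contribute to the divisor.
variable {R} in
theorem exists_of_principalDiv_eq_cylinder {Z : WDiv R} {g : (FractionRing R[T;T⁻¹])ˣ}
    (hg : principalDiv g = Z.cylinder) :
    ∃ (c : (FractionRing R)ˣ) (n : ℤ), principalDiv c = Z ∧
      (g : FractionRing R[T;T⁻¹]) = fractionMap R R[T;T⁻¹] c *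
        algebraMap R[T;T⁻¹] (FractionRing R[T;T⁻¹]) (LaurentPolynomial.T 1) ^ n := by
  obtain ⟨c, n, hc, hgc⟩ := PrimeDivisor.exists_eq_fractionMap_mul_zpow g.ne_zero fun q hq ↦ by
    rw [← principalDiv_apply, hg, WDiv.cylinder_apply_of_notMem_range _ hq]
  refine ⟨Units.mk0 c hc, n, WDiv.cylinder_injective ?_, hgc⟩
  have hT : algebraMap R[T;T⁻¹] (FractionRing R[T;T⁻¹]) (LaurentPolynomial.T 1) ≠ 0 :=
    ((LaurentPolynomial.isUnit_T 1).map _).ne_zero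
  rw [← hg, WDiv.cylinder_principalDiv]
  ext q
  rw [principalDiv_apply, principalDiv_apply, hgc, PrimeDivisor.ord_mul _
    ((map_ne_zero _).2 hc) (zpow_ne_zero n hT), PrimeDivisor.ord_zpow _ hT, PrimeDivisor.ord_T,
    mul_zero, add_zero]
  rfl

theorem DivisorClassGroup.cylinder_bijective :
    Function.Bijective (DivisorClassGroup.cylinder R) := by
  constructor
  · rw [injective_iff_map_eq_zero]
    intro x hx
    obtain ⟨Z, rfl⟩ := divisorClass_surjective x
    rw [cylinder_divisorClass, divisorClass_eq_zero_iff] at hx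
    obtain ⟨g, hg⟩ := hx
    obtain ⟨c, -, hc, -⟩ := exists_of_principalDiv_eq_cylinder hg
    exact divisorClass_eq_zero_iff.2 ⟨c, hc⟩
  · intro x
    obtain ⟨Z, rfl⟩ := divisorClass_surjective x
    obtain ⟨W, g, rfl⟩ := Z.exists_cylinder_add_principalDiv
    refine ⟨divisorClass W, ?_⟩
    rw [cylinder_divisorClass]
    exact ((add_zero _).symm.trans (congrArg _ (divisorClass_principalDiv g).symm) :
      divisorClass W.cylinder = divisorClass W.cylinder + divisorClass (principalDiv g))

end Cylinder

namespace SuspRing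

variable {R : Type*} [CommRing R] [IsDomain R] [IsNoetherianRing R] [IsIntegrallyClosed R]
  {f : R} [NeZero f]

instance : NeZero (u f) := ⟨u_ne_zero⟩

omit [IsDomain R] [IsNoetherianRing R] [IsIntegrallyClosed R] [NeZero f] in
/-- A divisor restricts to zero on `{u ≠ 0}` exactly if all its components lie in `{u = 0}`. -/
theorem restrict_eq_zero_iff {Z : WDiv (SuspRing R f)} :
    Z.restrict (u f) R[T;T⁻¹] = 0 ↔
      ∀ q : PrimeDivisor (SuspRing R f), u f ∉ q.asIdeal → Z q = 0 := by
  constructor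
  · intro h q hq
    rw [← q.contract_restrict (u f) (B := R[T;T⁻¹]) hq, ← WDiv.restrict_apply, h]
    rfl
  · intro h
    ext q
    rw [WDiv.restrict_apply]
    exact h _ (q.notMem_contract (u f))

/-- Without zeros and poles on `X_u`, `g` is `c * u ^ n` with `c` a function on `Y` of divisor zero;
only `u ^ n` contributes along `𝔸¹ × E`. -/
theorem exists_ord_divisorOver_eq {g : (FractionRing (SuspRing R f))ˣ}
    (hg : (principalDiv g).restrict (u f) R[T;T⁻¹] = 0) :
    ∃ n : ℤ, ∀ (p : PrimeDivisor R) (hf : f ∈ p.asIdeal),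
      principalDiv g (divisorOver p hf) = n * p.ord (algebraMap R (FractionRing R) f) := by
  rw [WDiv.restrict_principalDiv, ← map_zero (WDiv.cylinder (R := R))] at hg
  obtain ⟨c, n, hc, hgc⟩ := exists_of_principalDiv_eq_cylinder hg
  have hu : algebraMap _ (FractionRing (SuspRing R f)) (u f) ≠ 0 := by simpa using! u_ne_zero
  have hg' : (g : FractionRing (SuspRing R f)) =
      fractionMap R (SuspRing R f) c * algebraMap _ _ (u f) ^ n := by
    -- The normal form holds on `X_u`, where `u` becomes `T`; injectivity on function fields carries
    -- it back to `X`.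
    apply (fractionMap (SuspRing R f) R[T;T⁻¹]).injective
    rw [map_mul, map_zpow₀, fractionMap_fractionMap, fractionMap_algebraMap,
      algebraMap_laurent_apply, toLaurent_u]
    exact hgc
  refine ⟨n, fun p hf ↦ ?_⟩
  have hcp : p.ord (c : FractionRing R) = 0 := by
    rw [← principalDiv_apply, hc]
    rfl
  rw [principalDiv_apply, hg', PrimeDivisor.ord_mul _ ((map_ne_zero _).2 c.ne_zero)
    (zpow_ne_zero n hu), PrimeDivisor.ord_zpow _ hu, ord_divisorOver, ord_divisorOver_u, hcp,
    zero_add]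

end SuspRing

/-! ### The exact sequence. -/

theorem proposition4p2 {K : Type*} [Field K] [IsAlgClosed K] [CharZero K]
    {R : Type*} [CommRing R] [Algebra K R] [Algebra.FiniteType K R] [IsNoetherianRing R]
    [IsDomain R] [IsIntegrallyClosed R]
    (f : R) [NeZero f] (hf : ¬ IsUnit f)
    (s : ℕ) (E : Fin s → PrimeDivisor R) (hE_inj : Function.Injective E)
    (hE : ∀ p : PrimeDivisor R, p ∈ Set.range E ↔ f ∈ p.asIdeal)
    (a : Fin s → ℤ)
    (ha : principalDiv (regularUnit f) = ∑ i, a i • (Finsupp.single (E i) 1 : WDiv R)) :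
    ∃ (D : Fin s → PrimeDivisor (SuspRing R f))
      (φ : DivisorClassGroup (SuspRing R f) →+ DivisorClassGroup R[T;T⁻¹])
      (θ : DivisorClassGroup R ≃+ DivisorClassGroup R[T;T⁻¹])
      (ξ : ℤ →+ (Fin s → ℤ))
      (ψ : (Fin s → ℤ) →+ DivisorClassGroup (SuspRing R f))
      (φ' : DivisorClassGroup (SuspRing R f) →+ DivisorClassGroup R),
      (∀ i, (D i).asIdeal = Ideal.span {SuspRing.u f} ⊔
        (E i).asIdeal.map (algebraMap R (SuspRing R f))) ∧
      (∀ q : PrimeDivisor (SuspRing R f), q ∈ Set.range D ↔ SuspRing.u f ∈ q.asIdeal) ∧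
      (∀ Z : WDiv (SuspRing R f),
        φ (divisorClass Z) = divisorClass (Z.restrict (SuspRing.u f) R[T;T⁻¹])) ∧
      (∀ Z : WDiv R, θ (divisorClass Z) = divisorClass Z.cylinder) ∧
      ξ 1 = a ∧
      (∀ b, ψ b = ∑ i, b i • divisorClass (Finsupp.single (D i) 1)) ∧
      (∀ x, φ' x = θ.symm (φ x)) ∧
      Function.Injective ξ ∧ Function.Exact ξ ψ ∧ Function.Exact ψ φ' ∧
      Function.Surjective φ' := by
  have hfE (i : Fin s) : f ∈ (E i).asIdeal := (hE _).1 ⟨i, rfl⟩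
  have haE (i : Fin s) : a i = (E i).ord (algebraMap R (FractionRing R) f) := by
    rw [← WDiv.sum_smul_single_apply hE_inj a i, ← ha]
    rfl
  let D (i : Fin s) : PrimeDivisor (SuspRing R f) := SuspRing.divisorOver (E i) (hfE i)
  have hD_inj : Function.Injective D := by
    intro i j hij
    apply hE_inj
    ext1
    rw [← SuspRing.comap_divisorOver (E i) (hfE i), ← SuspRing.comap_divisorOver (E j) (hfE j)]
    exact congrArg (fun q : PrimeDivisor (SuspRing R f) ↦ q.asIdeal.comap _) hij
  have hD (q : PrimeDivisor (SuspRing R f)) : q ∈ Set.range D ↔ SuspRing.u f ∈ q.asIdeal := by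
    constructor
    · rintro ⟨i, rfl⟩
      exact SuspRing.u_mem_idealOver f _
    · intro hq
      obtain ⟨p, hfp, rfl⟩ := SuspRing.exists_eq_divisorOver hq
      obtain ⟨i, rfl⟩ := (hE p).2 hfp
      exact ⟨i, rfl⟩
  let S (b : Fin s → ℤ) : WDiv (SuspRing R f) := ∑ i, b i • Finsupp.single (D i) 1
  have hS_restrict (b : Fin s → ℤ) : (S b).restrict (SuspRing.u f) R[T;T⁻¹] = 0 :=
    SuspRing.restrict_eq_zero_iff.2 fun q hq ↦
      WDiv.sum_smul_single_apply_of_notMem b fun h ↦ hq ((hD q).1 h)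
  -- A divisor supported in `{u = 0}` is determined by its coefficients at the `D i`.
  have hS_ext {Z : WDiv (SuspRing R f)} (b : Fin s → ℤ)
      (hZ : Z.restrict (SuspRing.u f) R[T;T⁻¹] = 0) (hb : ∀ i, Z (D i) = b i) : Z = S b := by
    ext q
    by_cases hq : q ∈ Set.range D
    · obtain ⟨i, rfl⟩ := hq
      rw [hb, WDiv.sum_smul_single_apply hD_inj]
    · rw [SuspRing.restrict_eq_zero_iff.1 hZ q fun h ↦ hq ((hD q).2 h),
        WDiv.sum_smul_single_apply_of_notMem b hq]
  have hS_a : principalDiv (regularUnit (SuspRing.u f)) = S a := by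
    refine hS_ext a (SuspRing.restrict_eq_zero_iff.2 fun q hq ↦ q.ord_algebraMap_eq_zero hq) ?_
    intro i
    rw [haE]
    exact SuspRing.ord_divisorOver_u (E i) (hfE i)
  let φ := DivisorClassGroup.restrict (SuspRing.u f) R[T;T⁻¹]
  let θ := AddEquiv.ofBijective _ (DivisorClassGroup.cylinder_bijective R)
  let ψ : (Fin s → ℤ) →+ DivisorClassGroup (SuspRing R f) :=
    (QuotientAddGroup.mk' (principalDivHom (SuspRing R f)).range).comp
      (AddMonoidHom.mk' S fun b c ↦ by
        simp only [S, Pi.add_apply, add_smul, Finset.sum_add_distrib])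
  have hψ (b : Fin s → ℤ) : ψ b = divisorClass (S b) := rfl
  have hφ' (x : DivisorClassGroup (SuspRing R f)) : θ.symm (φ x) = 0 ↔ φ x = 0 :=
    EmbeddingLike.map_eq_zero_iff
  refine ⟨D, φ, θ, zmultiplesHom _ a, ψ, θ.symm.toAddMonoidHom.comp φ, fun _ ↦ rfl, hD,
    fun _ ↦ rfl, fun _ ↦ rfl, one_smul ℤ a, fun b ↦ divisorClass_sum_smul Finset.univ b _,
    fun _ ↦ rfl, ?_, ?_, ?_, ?_⟩
  -- As `f` is not a unit, it vanishes on some `E i`; then `a i ≠ 0`, which makes `ξ` injective.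
  · obtain ⟨m, hm, hfm⟩ := Ideal.exists_le_maximal _ (mt Ideal.span_singleton_eq_top.1 hf)
    obtain ⟨p, hfp, -⟩ := PrimeDivisor.exists_le_of_mem (q := m) (NeZero.ne f)
      ((Ideal.span_singleton_le_iff_mem m).1 hfm)
    obtain ⟨i, rfl⟩ := (hE p).2 hfp
    have hai : a i ≠ 0 := by
      rw [haE]
      exact ((E i).ord_algebraMap_pos (NeZero.ne f) hfp).ne'
    intro m n hmn
    exact mul_right_cancel₀ hai (congrFun hmn i)
  · intro b
    rw [hψ, divisorClass_eq_zero_iff]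
    constructor
    · rintro ⟨g, hg⟩
      obtain ⟨n, hn⟩ := SuspRing.exists_ord_divisorOver_eq (hg ▸ hS_restrict b)
      refine ⟨n, funext fun i ↦ ?_⟩
      rw [← WDiv.sum_smul_single_apply hD_inj b i]
      change n * a i = S b (D i)
      rw [← hg, haE]
      exact (hn _ _).symm
    · rintro ⟨n, rfl⟩
      rw [← divisorClass_eq_zero_iff, ← hψ, zmultiplesHom_apply, map_zsmul, hψ, ← hS_a,
        divisorClass_principalDiv, zsmul_zero]
  · intro x
    change θ.symm (φ x) = 0 ↔ _
    rw [hφ']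
    constructor
    · obtain ⟨Z, rfl⟩ := divisorClass_surjective x
      intro hZ
      obtain ⟨g, hg⟩ := divisorClass_eq_zero_iff.1 hZ
      -- The function trivializing `Z` on `X_u` is a rational function on `X`; subtracting its
      -- divisor there leaves a divisor supported in `{u = 0}`.
      obtain ⟨h, hh⟩ := fractionMap_surjective_of_away (SuspRing.u f) (g : FractionRing R[T;T⁻¹])
      have h0 : h ≠ 0 := by
        rintro rfl
        exact g.ne_zero (by rw [← hh, map_zero])
      have hgh : g = Units.map (fractionMap (SuspRing R f) R[T;T⁻¹]).toMonoidHom (Units.mk0 h h0) :=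
        Units.ext hh.symm
      rw [hgh, ← WDiv.restrict_principalDiv (SuspRing.u f)] at hg
      refine ⟨fun i ↦ (Z - principalDiv (Units.mk0 h h0)) (D i), ?_⟩
      rw [hψ, ← hS_ext (Z := Z - principalDiv (Units.mk0 h h0)) _
        (by rw [map_sub, hg, sub_self]) fun _ ↦ rfl]
      change divisorClass Z - divisorClass (principalDiv (Units.mk0 h h0)) = _
      rw [divisorClass_principalDiv, sub_zero]
    · rintro ⟨b, rfl⟩
      rw [hψ]
      change divisorClass ((S b).restrict (SuspRing.u f) R[T;T⁻¹]) = 0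
      rw [hS_restrict]
      rfl
  · refine θ.symm.surjective.comp fun x ↦ ?_
    obtain ⟨W, rfl⟩ := divisorClass_surjective x
    obtain ⟨Z, rfl⟩ := WDiv.restrict_surjective (SuspRing.u f) W
    exact ⟨divisorClass Z, rfl⟩
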